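/- **Theorem.** Let $p$ be an odd prime, let $X=\{0,1,\dots,p-1\}$, identified with $\mathbb F_p$, and let $X^*$ be the $p$-regular rooted tree, whose vertices are the finite words over $X$, the root being the empty word, and in which a word $u$ is joined to the words $ux$ for $x\in X$. Let $\mathbf e=(e_1,\dots,e_{p-1})\in\mathbb F_p^{\,p-1}$ be a non-constant tuple, i.e. not all of its entries are equal. Let $G=\langle a,b\rangle\le\operatorname{Aut}(X^*)$ be the GGS-group with defining tuple $\mathbf e$. Here $a$ is the rooted automorphism that maps a word $xw$ with $x\in X$ to $(x+1)w$ (addition modulo $p$), and $b$ is the automorphism that fixes the first level, acts on the subtree below $0$ as $b$ itself, and acts on the subtree below $x$ as $a^{e_x}$ for $x\in\{1,\dots,p-1\}$; that is, $b(0w)=0\,b(w)$ and $b(xw)=x\,a^{e_x}(w)$ for $x\ne0$. For a tuple $\mathbf d=(d_1,\dots,d_k)$ over $\mathbb F_p$, let its difference tuple be $\mathbf d'=(d_1-d_2,\dots,d_{k-1}-d_k)$, and put $\mathbf e''=(\mathbf e')'$. Let $\operatorname{con}(\mathbf d)=1$ if all entries of $\mathbf d$ are equal, and $\operatorname{con}(\mathbf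 d)=0$ otherwise. Let $\operatorname{sym}(\mathbf d)=1$ if $d_i=d_{k+1-i}$ for all $i$, and $\operatorname{sym}(\mathbf d)=0$ otherwise. (For $p=3$ the tuple $\mathbf e''$ is empty, hence symmetric.) Let $G^{(0)}=G$ and let $G^{(n+1)}=[G^{(n)},G^{(n)}]$ be the derived series of $G$. Then for every $n\ge1$ the index $|G:G^{(n)}|$ is finite, and $$ \log_p|G:G^{(n)}|=\begin{cases} 2 & \text{if } n=1,\\[4pt] p^{n-2}\bigl(p+\operatorname{con}(\mathbf e')+\operatorname{sym}(\mathbf e'')\bigr)-\dfrac{p^{n-1}-1}{p-1}\,\operatorname{sym}(\mathbf e)+1 & \text{if } n\ge2. \end{cases} $$ -/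

import Mathlib

/-- The vertices of the `p`-regular rooted tree `X^*`: finite words over `X = {0, …, p-1} = 𝔽_p`.
The root is the empty word. -/
abbrev TreeVertex (p : ℕ) : Type := List (ZMod p)

/-- The `p`-regular rooted tree: the Cayley graph of the free monoid on `X`, in which two words are
adjacent iff one of them arises from the other by appending one letter. -/
def regularTree (p : ℕ) : SimpleGraph (TreeVertex p) where
  Adj u v := (∃ x, v = u ++ [x]) ∨ (∃ x, u = v ++ [x])
  symm := ⟨fun _ _ h => h.symm⟩
  loopless := ⟨fun u h => by
    rcases h with ⟨x, h⟩ | ⟨x, h⟩ <;> simpa using congrArg List.length h⟩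

/-- The automorphism group `Aut(X^*)` of the `p`-regular rooted tree. -/
abbrev TreeAut (p : ℕ) : Type := regularTree p ≃g regularTree p

theorem regularTree_adj_map {p : ℕ} {f : TreeVertex p → TreeVertex p}
    (hf : ∀ u x, ∃ y, f (u ++ [x]) = f u ++ [y]) {u v : TreeVertex p}
    (h : (regularTree p).Adj u v) : (regularTree p).Adj (f u) (f v) := by
  rcases h with ⟨x, rfl⟩ | ⟨x, rfl⟩
  · exact Or.inl (hf _ _)
  · exact Or.inr (hf _ _)

/-- Two mutually inverse maps on words that send children to children form a tree automorphism. -/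
def TreeAut.ofMaps {p : ℕ} (f g : TreeVertex p → TreeVertex p)
    (hgf : ∀ w, g (f w) = w) (hfg : ∀ w, f (g w) = w)
    (hf : ∀ u x, ∃ y, f (u ++ [x]) = f u ++ [y])
    (hg : ∀ u x, ∃ y, g (u ++ [x]) = g u ++ [y]) : TreeAut p where
  toFun := f
  invFun := g
  left_inv := hgf
  right_inv := hfg
  map_rel_iff' := by
    intro u v
    refine ⟨fun h => ?_, fun h => regularTree_adj_map hf h⟩
    have h' := regularTree_adj_map hg h
    simpa [hgf] using h'

/-- The map on words adding `k` to the first letter. -/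
def rotateFun {p : ℕ} (k : ZMod p) : TreeVertex p → TreeVertex p
  | [] => []
  | x :: w => (x + k) :: w

theorem rotateFun_rotateFun {p : ℕ} (k l : ZMod p) (w : TreeVertex p) :
    rotateFun k (rotateFun l w) = rotateFun (l + k) w := by
  cases w <;> simp [rotateFun, add_assoc]

theorem rotateFun_zero {p : ℕ} (w : TreeVertex p) : rotateFun 0 w = w := by
  cases w <;> simp [rotateFun]

theorem rotateFun_append {p : ℕ} (k : ZMod p) (u : TreeVertex p) (x : ZMod p) :
    ∃ y, rotateFun k (u ++ [x]) = rotateFun k u ++ [y] := by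
  cases u <;> simp [rotateFun]

/-- The rooted automorphism given by the permutation `x ↦ x + k` of the first level. -/
def rotate {p : ℕ} (k : ZMod p) : TreeAut p :=
  TreeAut.ofMaps (rotateFun k) (rotateFun (-k))
    (fun w => by rw [rotateFun_rotateFun, add_neg_cancel, rotateFun_zero])
    (fun w => by rw [rotateFun_rotateFun, neg_add_cancel, rotateFun_zero])
    (rotateFun_append k) (rotateFun_append (-k))

/-- The rooted generator `a = (0 1 … p-1)`. -/
def rootedGen (p : ℕ) : TreeAut p := rotate 1

/-- `rotate k` is the power `a ^ k`, for `k ∈ 𝔽_p`. -/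
theorem rotate_eq_rootedGen_pow {p : ℕ} [NeZero p] (k : ZMod p) :
    rotate k = rootedGen p ^ k.val := by
  have h : ∀ n : ℕ, rotate (n : ZMod p) = rootedGen p ^ n := by
    intro n
    induction n with
    | zero =>
      ext1 w
      change rotateFun _ w = w
      rw [Nat.cast_zero, rotateFun_zero]
    | succ n ih =>
      rw [pow_succ, ← ih]
      ext1 w
      change rotateFun _ w = rotateFun _ (rotateFun _ w)
      rw [rotateFun_rotateFun, Nat.cast_succ, add_comm]
  rw [← h, ZMod.natCast_zmod_val]

/-- A tuple `e = (e_1, …, e_{p-1})` is stored as a function on `Fin (p - 1)`; for a letter `x ≠ 0`,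
identified with an element of `{1, …, p-1}`, this is the entry `e_x`. -/
def tupleEntry {p : ℕ} [NeZero p] (e : Fin (p - 1) → ZMod p) (x : ZMod p) (hx : x ≠ 0) : ZMod p :=
  e ⟨x.val - 1, by
    have h1 := ZMod.val_lt x
    have h2 : x.val ≠ 0 := (ZMod.val_ne_zero x).2 hx
    omega⟩

/-- The map on words underlying the directed generator. -/
def directedFun {p : ℕ} [NeZero p] (e : Fin (p - 1) → ZMod p) : TreeVertex p → TreeVertex p
  | [] => []
  | x :: w => if hx : x = 0 then x :: directedFun e w
      else x :: rotateFun (tupleEntry e x hx) w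

theorem directedFun_neg {p : ℕ} [NeZero p] (e d : Fin (p - 1) → ZMod p) (h : ∀ i, e i + d i = 0)
    (w : TreeVertex p) : directedFun d (directedFun e w) = w := by
  induction w with
  | nil => rfl
  | cons x w ih =>
    by_cases hx : x = 0
    · simp [directedFun, hx, ih]
    · simp [directedFun, hx, rotateFun_rotateFun, tupleEntry, h, rotateFun_zero]

theorem directedFun_append {p : ℕ} [NeZero p] (e : Fin (p - 1) → ZMod p) (u : TreeVertex p)
    (x : ZMod p) : ∃ y, directedFun e (u ++ [x]) = directedFun e u ++ [y] := by
  induction u with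
  | nil =>
    refine ⟨x, ?_⟩
    by_cases hx : x = 0 <;> simp [directedFun, rotateFun, hx]
  | cons z u ih =>
    by_cases hz : z = 0
    · simpa [directedFun, hz] using ih
    · simpa [directedFun, hz] using rotateFun_append (tupleEntry e z hz) u x

/-- The directed generator `b`: it fixes the first level, its section at `0` is `b` itself, and its
section at `x ≠ 0` is `a ^ e_x`. -/
def directedGen {p : ℕ} [NeZero p] (e : Fin (p - 1) → ZMod p) : TreeAut p :=
  TreeAut.ofMaps (directedFun e) (directedFun (-e))
    (directedFun_neg e (-e) fun i => by simp)
    (directedFun_neg (-e) e fun i => by simp)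
    (directedFun_append e) (directedFun_append (-e))

theorem directedGen_cons_zero {p : ℕ} [NeZero p] (e : Fin (p - 1) → ZMod p) (w : TreeVertex p) :
    directedGen e (0 :: w) = 0 :: directedGen e w := by
  change directedFun e (0 :: w) = 0 :: directedFun e w
  simp [directedFun]

theorem directedGen_cons {p : ℕ} [NeZero p] (e : Fin (p - 1) → ZMod p) (x : ZMod p) (hx : x ≠ 0)
    (w : TreeVertex p) :
    directedGen e (x :: w) = x :: (rootedGen p ^ (tupleEntry e x hx).val) w := by
  rw [← rotate_eq_rootedGen_pow]
  change directedFun e (x :: w) = x :: rotateFun _ w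
  simp [directedFun, hx]

/-- The GGS-group `G_e = ⟨a, b⟩ ≤ Aut(X^*)` with defining tuple `e`. -/
def GGSGroup {p : ℕ} [NeZero p] (e : Fin (p - 1) → ZMod p) : Subgroup (TreeAut p) :=
  Subgroup.closure {rootedGen p, directedGen e}

/-- The tuple of differences `d_i - d_{i+1}` between neighbouring entries of a tuple `d`. -/
def diffTuple {p n : ℕ} (d : Fin n → ZMod p) : Fin (n - 1) → ZMod p :=
  fun i => d ⟨i, by omega⟩ - d ⟨i + 1, by omega⟩

/-- A tuple is constant if all its entries are equal. -/
def IsConstantTuple {p n : ℕ} (d : Fin n → ZMod p) : Prop := ∀ i j, d i = d j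

/-- A tuple is symmetric if its `i`-th entry equals its `i`-th-to-last entry, for all `i`. -/
def IsSymmetricTuple {p n : ℕ} (d : Fin n → ZMod p) : Prop := ∀ i, d i = d i.rev

open Classical in
/-- `con(d)` is `1` if `d` is constant, and `0` otherwise. -/
noncomputable def con {p n : ℕ} (d : Fin n → ZMod p) : ℕ := if IsConstantTuple d then 1 else 0

open Classical in
/-- `sym(d)` is `1` if `d` is symmetric, and `0` otherwise. -/
noncomputable def sym {p n : ℕ} (d : Fin n → ZMod p) : ℕ := if IsSymmetricTuple d then 1 else 0

/-! Let K be the stabilizer of the first level and ψ : K → G^p the section map, which is injective.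
K is generated by the conjugates b_i = a^i b a^{-i}. The b-exponents of the sections identify K/K'
with F_p^p. Moreover G/G' ≅ F_p^2 and G'/γ₃(G) ≅ F_p, so |G : γ₃(G)| = p^3 and |G : K'| = p^(p+1).

The key fact is that ψ(G'') contains γ₃(G)^p (`gamma₃_le_rist`). For h in G', the element [[b_m,
b_0], h] of G'' has at most two non-trivial sections. A further commutator with an element of K with
trivial section at 0 leaves only one of them, which gives γ₄(G)^p (`gamma₄_le_rist`). Modulo γ₄(G)
the question is linear algebra over F_p[C_p], and Nakayama's lemma reduces it to a functional
equation in the defining tuple (`functional_eq_zero`).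

Hence ψ(K') and ψ(G'') lie between γ₃(G)^p and (G')^p, and each is determined by a shift-invariant
subspace of (G'/γ₃(G))^p = F_p^p. The codimension of such a subspace is the order of the first
moment ∑ k^i w_k that does not vanish on it (`eq_momentKer`, for orders up to 2). The moments of
[b_i, b_j] are explicit in e, and the codimensions are sym(e) for K' and con(e') + sym(e'') for G''.
This settles |G : G''|.

Finally, G'/γ₃(G) is cyclic, so G'' = [G', γ₃(G)]; as every element of G' is a section of an element
of G'', it follows that ψ(G''') = (G'')^p, and inductively ψ(G^(n+1)) = (G^(n))^p for n ≥ 2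
(`derivedSeries_succ_eq`). The logarithms l_n of the indices therefore satisfy l_(n+1) = p(l_n - 3)
+ (p - sym(e)) + (p + 1), which the stated formula solves. -/

open scoped commutatorElement

/-! ### Shift-invariant subspaces of functions on F_p -/

section CyclicLinearAlgebra

variable {p : ℕ} [Fact p.Prime]

theorem ZMod.two_ne_zero_of_ne (hp : p ≠ 2) : (2 : ZMod p) ≠ 0 := fun h => by
  have : p ∣ 2 := (ZMod.natCast_eq_zero_iff 2 p).1 (by exact_mod_cast h)
  rcases (Nat.dvd_prime Nat.prime_two).1 this with h | h
  · exact (Fact.out : p.Prime).one_lt.ne' h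
  · exact hp h

/-- The difference operator `w ↦ (k ↦ w (k + 1) - w k)` on functions on `ZMod p`. -/
def cyclicDiff (p : ℕ) (V : Type*) [AddCommGroup V] [Module (ZMod p) V] :
    Module.End (ZMod p) (ZMod p → V) :=
  LinearMap.funLeft (ZMod p) V (fun k => k + 1) - 1

variable {V : Type*} [AddCommGroup V] [Module (ZMod p) V]

theorem cyclicDiff_apply (w : ZMod p → V) (k : ZMod p) :
    cyclicDiff p V w k = w (k + 1) - w k := rfl

theorem funLeft_add_one_pow (n : ℕ) (w : ZMod p → V) (k : ZMod p) :
    ((LinearMap.funLeft (ZMod p) V (fun k : ZMod p => k + 1) : Module.End (ZMod p) _) ^ n) w k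
      = w (k + n) := by
  induction n generalizing k with
  | zero => rw [pow_zero, Nat.cast_zero, add_zero]; rfl
  | succ n ih =>
    rw [pow_succ', Module.End.mul_apply]
    change ((_ : Module.End (ZMod p) (ZMod p → V)) ^ n) w (k + 1) = _
    rw [ih]; congr 1; push_cast; ring

/-- In characteristic p one has (X - 1)^p = X^p - 1, and the shift has order dividing p. -/
theorem cyclicDiff_pow_prime : (cyclicDiff p V) ^ p = 0 := by
  have h : (Polynomial.X - 1 : Polynomial (ZMod p)) ^ p = Polynomial.X ^ p - 1 := by
    rw [sub_pow_char]; simp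
  have h2 := congrArg (Polynomial.aeval
    (LinearMap.funLeft (ZMod p) V (fun k : ZMod p => k + 1) : Module.End (ZMod p) _)) h
  simp only [map_pow, map_sub, Polynomial.aeval_X, map_one] at h2
  rw [cyclicDiff, h2]
  refine LinearMap.ext fun w => funext fun k => ?_
  rw [LinearMap.sub_apply, Pi.sub_apply, funLeft_add_one_pow]
  simp

/-- The partial sums of w are a primitive; they close up around the cycle because the total sum is
zero. -/
theorem exists_cyclicDiff_eq {w : ZMod p → V} (h : ∑ k, w k = 0) :
    ∃ z, w = cyclicDiff p V z := by
  have hp : 0 < p := (Fact.out : p.Prime).pos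
  have hsum : ∑ i ∈ Finset.range p, w i = 0 := by
    rw [← h]
    refine Finset.sum_bij (fun i _ => (i : ZMod p)) (fun _ _ => Finset.mem_univ _) ?_ ?_ ?_
    · intro i hi j hj hij
      have := congrArg ZMod.val hij
      rwa [ZMod.val_cast_of_lt (Finset.mem_range.1 hi),
        ZMod.val_cast_of_lt (Finset.mem_range.1 hj)] at this
    · intro k _
      exact ⟨k.val, Finset.mem_range.2 (ZMod.val_lt k), by simp⟩
    · intro _ _; rfl
  refine ⟨fun k => ∑ i ∈ Finset.range k.val, w i, ?_⟩
  funext k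
  rw [cyclicDiff_apply]
  rcases Nat.lt_or_ge (k.val + 1) p with hk | hk
  · have : (k + 1).val = k.val + 1 := by
      have : k + 1 = ((k.val + 1 : ℕ) : ZMod p) := by simp
      rw [this, ZMod.val_cast_of_lt hk]
    rw [this, Finset.sum_range_succ]; simp
  · have hk' : k.val + 1 = p := le_antisymm (ZMod.val_lt k) hk
    have h0 : k + 1 = 0 := by
      have : k + 1 = ((k.val + 1 : ℕ) : ZMod p) := by simp
      rw [this, hk', ZMod.natCast_self]
    have hr : Finset.range p = Finset.range (k.val + 1) := by rw [hk']
    rw [hr, Finset.sum_range_succ] at hsum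
    rw [h0, ZMod.val_zero, Finset.sum_range_zero, zero_sub, eq_neg_iff_add_eq_zero, add_comm]
    simpa using hsum

theorem cyclicDiff_mem {T : Submodule (ZMod p) (ZMod p → V)}
    (hT : ∀ w ∈ T, (fun k => w (k + 1)) ∈ T) {w : ZMod p → V} (hw : w ∈ T) :
    cyclicDiff p V w ∈ T :=
  T.sub_mem (hT w hw) hw

/-- Nakayama's lemma for shift-invariant spaces of functions on `ZMod p`. -/
theorem le_of_forall_exists_add_cyclicDiff {T U : Submodule (ZMod p) (ZMod p → V)}
    (hT : ∀ w ∈ T, (fun k => w (k + 1)) ∈ T)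
    (h : ∀ v ∈ U, ∃ t ∈ T, ∃ u ∈ U, v = t + cyclicDiff p V u) : U ≤ T := by
  -- The hypothesis is substituted into itself n times; at n = p the remainder vanishes by
  -- nilpotency.
  have key : ∀ n : ℕ, ∀ v ∈ U, ∃ t ∈ T, ∃ u ∈ U, v = t + ((cyclicDiff p V) ^ n) u := by
    intro n
    induction n with
    | zero => exact fun v hv => ⟨0, T.zero_mem, v, hv, by simp⟩
    | succ n ih =>
      intro v hv
      obtain ⟨t, ht, u, hu, rfl⟩ := h v hv
      obtain ⟨t', ht', u', hu', rfl⟩ := ih u hu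
      refine ⟨t + cyclicDiff p V t', T.add_mem ht (cyclicDiff_mem hT ht'), u', hu', ?_⟩
      rw [map_add, add_assoc, pow_succ', Module.End.mul_apply]
  intro v hv
  obtain ⟨t, ht, u, -, rfl⟩ := key p v hv
  simpa [cyclicDiff_pow_prime] using ht

/-- Functions with sum zero are differences, so T is everything as soon as it is everything modulo
differences. -/
theorem eq_top_of_forall_exists_sum_eq {T : Submodule (ZMod p) (ZMod p → V)}
    (hT : ∀ w ∈ T, (fun k => w (k + 1)) ∈ T) (h : ∀ v, ∃ t ∈ T, ∑ k, t k = v) : T = ⊤ := by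
  refine top_le_iff.1 (le_of_forall_exists_add_cyclicDiff hT ?_)
  intro v _
  obtain ⟨t, ht, hs⟩ := h (∑ k, v k)
  obtain ⟨z, hz⟩ := exists_cyclicDiff_eq (w := v - t) (by simp [hs])
  exact ⟨t, ht, z, trivial, by rw [← hz]; abel⟩

/-- The functional `w ↦ ∑ k, k ^ i * w k`. -/
def moment (p : ℕ) [Fact p.Prime] (i : ℕ) : (ZMod p → ZMod p) →ₗ[ZMod p] ZMod p where
  toFun w := ∑ k, k ^ i * w k
  map_add' v w := by simp [mul_add, Finset.sum_add_distrib]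
  map_smul' c w := by simp [Finset.mul_sum, mul_left_comm]

theorem moment_apply (i : ℕ) (w : ZMod p → ZMod p) : moment p i w = ∑ k, k ^ i * w k := rfl

/-- The functions on `ZMod p` whose moments of order less than `d` vanish. -/
def momentKer (p : ℕ) [Fact p.Prime] (d : ℕ) : Submodule (ZMod p) (ZMod p → ZMod p) where
  carrier := {w | ∀ i < d, moment p i w = 0}
  add_mem' hv hw i hi := by rw [map_add, hv i hi, hw i hi, add_zero]
  zero_mem' i _ := map_zero _
  smul_mem' c w hw i hi := by rw [map_smul, hw i hi, smul_zero]

theorem mem_momentKer {d : ℕ} {w : ZMod p → ZMod p} :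
    w ∈ momentKer p d ↔ ∀ i < d, moment p i w = 0 := Iff.rfl

theorem moment_cyclicDiff (i : ℕ) (w : ZMod p → ZMod p) :
    moment p i (cyclicDiff p _ w) = ∑ k, ((k - 1) ^ i - k ^ i) * w k := by
  simp only [moment_apply, cyclicDiff_apply, mul_sub, sub_mul, Finset.sum_sub_distrib]
  congr 1
  refine Fintype.sum_equiv (Equiv.addRight 1) _ _ fun k => ?_
  simp

/-- The moment of order i + 1 of a difference of u is -(i + 1) times the moment of order i of u plus
lower moments of u. Only the factors 1 and 2 have to be invertible here. -/
theorem momentKer_succ_le_map {d : ℕ} (hd : d ≤ 2) (hp : p ≠ 2) {v : ZMod p → ZMod p}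
    (hv : v ∈ momentKer p (d + 1)) : ∃ u ∈ momentKer p d, v = cyclicDiff p _ u := by
  have h2 := ZMod.two_ne_zero_of_ne hp
  obtain ⟨u, rfl⟩ := exists_cyclicDiff_eq (w := v) (by simpa [moment_apply] using hv 0 (by omega))
  have h1 : 1 < d + 1 → moment p 0 u = 0 := fun h => by
    have := hv 1 h
    rw [moment_cyclicDiff] at this
    simpa [moment_apply] using this
  have h3 : 2 < d + 1 → moment p 1 u = 0 := fun h => by
    have := hv 2 h
    rw [moment_cyclicDiff] at this
    have e : ∑ k, ((k - 1) ^ 2 - k ^ 2) * u k = moment p 0 u - 2 * moment p 1 u := by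
      simp only [moment_apply, Finset.mul_sum, ← Finset.sum_sub_distrib]
      exact Finset.sum_congr rfl fun k _ => by ring
    rw [e, h1 (by omega), zero_sub, neg_eq_zero] at this
    exact (mul_eq_zero.1 this).resolve_left h2
  refine ⟨u, fun i hi => ?_, rfl⟩
  interval_cases d
  · omega
  · obtain rfl : i = 0 := by omega
    exact h1 (by omega)
  · interval_cases i
    · exact h1 (by omega)
    · exact h3 (by omega)

/-- A shift-invariant subspace killed by the moments of order less than `d`, but not by that of
order `d`, is the space of all functions killed by the former. -/
theorem eq_momentKer {T : Submodule (ZMod p) (ZMod p → ZMod p)}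
    (hT : ∀ w ∈ T, (fun k => w (k + 1)) ∈ T) {d : ℕ} (hd : d ≤ 2) (hp : p ≠ 2)
    (h : T ≤ momentKer p d) {w : ZMod p → ZMod p} (hw : w ∈ T) (hw0 : moment p d w ≠ 0) :
    T = momentKer p d := by
  refine le_antisymm h (le_of_forall_exists_add_cyclicDiff hT fun v hv => ?_)
  -- Removing a multiple of w kills the moment of order d, and what is left is a difference of an
  -- element of the same kernel.
  have hc : v - (moment p d v / moment p d w) • w ∈ momentKer p (d + 1) := by
    intro i hi
    rcases Nat.lt_succ_iff_lt_or_eq.1 hi with hi | rfl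
    · rw [map_sub, map_smul, hv i hi, h hw i hi, smul_zero, sub_zero]
    · rw [map_sub, map_smul, smul_eq_mul, div_mul_cancel₀ _ hw0, sub_self]
  obtain ⟨u, hu, h'⟩ := momentKer_succ_le_map hd hp hc
  exact ⟨_, T.smul_mem _ hw, u, hu, by rw [← h']; abel⟩

/-- The moments of orders 0 and 1 are already independent on functions supported at 0 and 1. -/
theorem card_momentKer {d : ℕ} (hd : d ≤ 2) :
    Nat.card (momentKer p d) * p ^ d = p ^ p := by
  let f : (ZMod p → ZMod p) →ₗ[ZMod p] (Fin d → ZMod p) := LinearMap.pi fun i => moment p i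
  have hker : momentKer p d = LinearMap.ker f := by
    ext w
    rw [LinearMap.mem_ker, mem_momentKer, funext_iff]
    exact ⟨fun h i => h i i.2, fun h i hi => h ⟨i, hi⟩⟩
  have hsurj : Function.Surjective f := by
    intro v
    interval_cases d
    · exact ⟨0, Subsingleton.elim _ _⟩
    · refine ⟨Pi.single 0 (v 0), funext fun i => ?_⟩
      fin_cases i
      simp [f, moment_apply, Pi.single_apply]
    · refine ⟨Pi.single 0 (v 0 - v 1) + Pi.single 1 (v 1), funext fun i => ?_⟩
      fin_cases i <;> simp [f, moment_apply, Pi.single_apply, mul_add, Finset.sum_add_distrib]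
  have h := LinearMap.finrank_range_add_finrank_ker f
  rw [LinearMap.range_eq_top.2 hsurj, finrank_top, Module.finrank_fin_fun,
    Module.finrank_fintype_fun_eq_card, ZMod.card] at h
  rw [hker, Module.natCard_eq_pow_finrank (K := ZMod p), Nat.card_zmod, ← pow_add, add_comm, h]

/-- Every iterated difference of E is a correlation with E. The last non-zero one is
shift-invariant, hence a non-zero constant, which is scaled to 1. -/
theorem exists_correlation_eq_one {E : ZMod p → ZMod p} (hE : E ≠ 0) :
    ∃ f : ZMod p → ZMod p, ∀ t, ∑ k, f k * E (k + t) = 1 := by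
  have h1 : ∀ n : ℕ, ∃ f : ZMod p → ZMod p, ∀ t,
      ((cyclicDiff p (ZMod p)) ^ n) E t = ∑ k, f k * E (k + t) := by
    intro n
    induction n with
    | zero => exact ⟨Pi.single 0 1, fun t => by simp [Pi.single_apply]⟩
    | succ n ih =>
      obtain ⟨f, hf⟩ := ih
      refine ⟨fun k => f (k - 1) - f k, fun t => ?_⟩
      rw [pow_succ', Module.End.mul_apply, cyclicDiff_apply, hf, hf]
      simp only [sub_mul, Finset.sum_sub_distrib]
      congr 1
      refine Fintype.sum_equiv (Equiv.addRight 1) _ _ fun k => ?_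
      simp [add_assoc, add_comm 1 t]
  classical
  have hex : ∃ n : ℕ, ((cyclicDiff p (ZMod p)) ^ n) E = 0 :=
    ⟨p, by rw [cyclicDiff_pow_prime]; rfl⟩
  obtain ⟨n, hn⟩ : ∃ n, Nat.find hex = n + 1 := by
    refine Nat.exists_eq_succ_of_ne_zero fun h0 => hE ?_
    have := Nat.find_spec hex
    rw [h0] at this
    simpa using this
  have hne : ((cyclicDiff p (ZMod p)) ^ n) E ≠ 0 := Nat.find_min hex (by omega)
  have hz := Nat.find_spec hex
  rw [hn, pow_succ', Module.End.mul_apply] at hz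
  set w := ((cyclicDiff p (ZMod p)) ^ n) E with hw
  have hconst : ∀ k, w (k + 1) = w k := fun k => sub_eq_zero.1 (congrFun hz k)
  have hnat : ∀ m : ℕ, w m = w 0 := by
    intro m
    induction m with
    | zero => simp
    | succ m ih => rw [Nat.cast_succ, hconst, ih]
  have hall : ∀ k, w k = w 0 := fun k => by simpa using hnat k.val
  have hw0 : w 0 ≠ 0 := fun h => hne (funext fun k => by rw [hall, h]; rfl)
  obtain ⟨f, hf⟩ := h1 n
  refine ⟨fun k => (w 0)⁻¹ * f k, fun t => ?_⟩
  simp only [mul_assoc, ← Finset.mul_sum]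
  rw [← hf, ← hw, hall t, inv_mul_cancel₀ hw0]

end CyclicLinearAlgebra

/-! ### Functional equations for the defining tuple -/

section TupleAlgebra

variable {p : ℕ} [Fact p.Prime]

theorem ZMod.add_induction {P : ZMod p → Prop} {m x₀ : ZMod p} (hm : m ≠ 0) (h₀ : P x₀)
    (hs : ∀ x, P x → P (x + m)) (x : ZMod p) : P x := by
  have key : ∀ n : ℕ, P (x₀ + n * m) := by
    intro n
    induction n with
    | zero => simpa using h₀
    | succ n ih =>
      have := hs _ ih
      rwa [show x₀ + n * m + m = x₀ + ((n + 1 : ℕ) : ZMod p) * m by push_cast; ring] at this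
  have := key ((x - x₀) / m).val
  rwa [ZMod.natCast_zmod_val, div_mul_cancel₀ _ hm, add_sub_cancel] at this

theorem ZMod.ne_neg_self_of_ne (hp : p ≠ 2) {m : ZMod p} (hm : m ≠ 0) : m ≠ -m := fun h => by
  have : (2 : ZMod p) * m = 0 := by linear_combination h
  rcases mul_eq_zero.1 this with h | h
  · exact ZMod.two_ne_zero_of_ne hp h
  · exact hm h

variable {E : ZMod p → ZMod p}

/-- The expression in `h` is a functional (l, u) on γ₃/γ₄, summed over the sections of [[b_m, b_0],
g] and expressed for g = b_i; its independence of i means that the functional kills the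
contributions of g = b_i b_j⁻¹. If l ≠ 0, this recursion along multiples of m would force E to be
constant off 0. -/
theorem functional_eq_zero (hp : p ≠ 2) (hE0 : E 0 = 0)
    (hE : ∃ x y, x ≠ 0 ∧ y ≠ 0 ∧ E x ≠ E y) {m : ZMod p} (hm : E m ≠ 0) {l u : ZMod p}
    (h : ∀ i j, -E m * (l * E (m - i) + u * if m = i then 1 else 0)
      + E (-m) * (l * E (-i) + u * if 0 = i then 1 else 0)
      = -E m * (l * E (m - j) + u * if m = j then 1 else 0)
      + E (-m) * (l * E (-j) + u * if 0 = j then 1 else 0)) : l = 0 ∧ u = 0 := by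
  have hm0 : m ≠ 0 := fun h => hm (by rw [h, hE0])
  have hmm := ZMod.ne_neg_self_of_ne hp hm0
  by_cases hl : l = 0
  · refine ⟨hl, ?_⟩
    have := h m (-m)
    rw [if_pos rfl, if_neg hmm, if_neg hm0.symm, if_neg (neg_ne_zero.2 hm0).symm, hl] at this
    have h2 : E m * u = 0 := by linear_combination -this
    exact (mul_eq_zero.1 h2).resolve_left hm
  · exfalso
    set F : ZMod p → ZMod p := fun i => l * E i + u * if i = 0 then 1 else 0 with hF
    have hFm : F m = l * E m := by simp [hF, hm0]
    have hFm' : F (-m) = l * E (-m) := by simp [hF, hm0]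
    have h1 : ∀ i j, -E m * F (i + m) + E (-m) * F i = -E m * F (j + m) + E (-m) * F j := by
      intro i j
      have h2 := h (-i) (-j)
      have e1 : ∀ i : ZMod p, (m = -i) = (i + m = 0) := fun i => by
        rw [eq_neg_iff_add_eq_zero, add_comm]
      have e2 : ∀ i : ZMod p, ((0 : ZMod p) = -i) = (i = 0) := fun i => by
        rw [zero_eq_neg]
      simp only [e1, e2, sub_neg_eq_add, neg_neg, add_comm m] at h2
      exact h2
    set d : ZMod p → ZMod p := fun i => F (i + m) - F i with hd
    set r := E (-m) / E m with hr
    have hrm : r * E m = E (-m) := div_mul_cancel₀ _ hm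
    have h3 : ∀ i, d (i + m) = r * d i := by
      intro i
      have := h1 (i + m) i
      refine mul_left_cancel₀ hm ?_
      simp only [hd]
      linear_combination -this - (F (i + m) - F i) * hrm
    have h4 : ∀ (n : ℕ) i, d (i + n * m) = r ^ n * d i := by
      intro n
      induction n with
      | zero => intro i; simp
      | succ n ih =>
        intro i
        rw [show i + ((n + 1 : ℕ) : ZMod p) * m = i + n * m + m by push_cast; ring, h3, ih]
        ring
    -- Adding m p times returns to i, while r ^ p = r.
    have h5 : ∀ i, (r - 1) * d i = 0 := by
      intro i
      have := h4 p i
      rw [ZMod.natCast_self, zero_mul, add_zero, ZMod.pow_card] at this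
      linear_combination -this
    have h6 : ∀ i, d i = 0 := by
      by_cases hr1 : r = 1
      · have hEm : E (-m) = E m := by rw [← hrm, hr1, one_mul]
        -- For r = 1 the values d 0 and d (-m) agree, but F m = F (-m) makes them opposite.
        have h7 : d (-m) = 0 := by
          have h8 := h3 (-m)
          rw [hr1, one_mul, neg_add_cancel] at h8
          have h9 : d 0 = F m - F 0 := by simp only [hd]; rw [zero_add]
          have h10 : d (-m) = F 0 - F (-m) := by simp only [hd]; rw [neg_add_cancel]
          have h11 : 2 * d (-m) = 0 := by
            rw [hFm', hEm] at h10
            rw [hFm] at h9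
            linear_combination h9 + h10 - h8
          exact (mul_eq_zero.1 h11).resolve_left (ZMod.two_ne_zero_of_ne hp)
        exact ZMod.add_induction hm0 h7 fun x hx => by rw [h3, hx, mul_zero]
      · exact fun i => (mul_eq_zero.1 (h5 i)).resolve_left (sub_ne_zero.2 hr1)
    have h7 : ∀ i, F i = F 0 :=
      ZMod.add_induction hm0 rfl fun x hx => by rw [← hx]; exact sub_eq_zero.1 (h6 x)
    obtain ⟨x, y, hx, hy, hxy⟩ := hE
    refine hxy (mul_left_cancel₀ hl ?_)
    have := (h7 x).trans (h7 y).symm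
    simpa [hF, hx, hy] using this

/-- Two-term recursions along multiples of `m` and `-m` determine a geometric tuple, whose ratio
is `1` only if the tuple is constant. -/
theorem exists_mul_ne_or_ne (hp : p ≠ 2) (hE0 : E 0 = 0)
    (hE : ∃ x y, x ≠ 0 ∧ y ≠ 0 ∧ E x ≠ E y) {m : ZMod p} (hm : E m ≠ 0) (hm' : E (-m) ≠ 0) :
    (∃ i j, i ≠ 0 ∧ i ≠ m ∧ j ≠ 0 ∧ j ≠ m ∧ E (m - i) * E (-j) ≠ E (m - j) * E (-i)) ∨
      E (m + m) * (-E (-m) / E m) ≠ E (-m + -m) * (-E m / E (-m)) := by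
  have hm0 : m ≠ 0 := fun h => hm (by rw [h, hE0])
  have hmm := ZMod.ne_neg_self_of_ne hp hm0
  by_contra! hcon
  obtain ⟨h1, h2⟩ := hcon
  set r := E (m + m) / E m with hr
  have hrm : r * E m = E (m + m) := div_mul_cancel₀ _ hm
  -- The failure of the first alternative says that E (i + m) / E i is the same ratio wherever
  -- neither argument is 0.
  have h3 : ∀ i, i ≠ 0 → i ≠ -m → E (i + m) = r * E i := by
    intro i hi him
    have := h1 (-i) (-m) (neg_ne_zero.2 hi) (fun h => him (by rw [← h, neg_neg]))
      (neg_ne_zero.2 hm0) hmm.symm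
    simp only [sub_neg_eq_add, neg_neg] at this
    refine mul_right_cancel₀ hm ?_
    rw [add_comm i m, this]
    linear_combination -E i * hrm
  have h4 := h3 (-m + -m) (fun h => hmm (eq_neg_of_add_eq_zero_left (neg_eq_zero.1 (by rw [neg_add, h]))))
    (fun h => hm0 (by linear_combination -h))
  rw [neg_add_cancel_right] at h4
  have h5 : E (m + m) * E (-m) ^ 2 = E (-m + -m) * E m ^ 2 := by
    generalize E (m + m) = x at h2
    generalize E (-m + -m) = y at h2
    field_simp at h2
    linear_combination -h2
  clear_value r
  have hr1 : r = 1 := by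
    have h7 : E (-m + -m) ≠ 0 := fun h => hm' (by rw [h4, h, mul_zero])
    -- This comes from the failure of the second alternative. Going through m, 2m, …, (p - 1)m and
    -- Fermat's little theorem give r * E (-m) = E m as well, hence r = 1.
    have h8 : r ^ 2 * E (-m) = E m := by
      have h9 : E (-m + -m) * E m * (r ^ 2 * E (-m) - E m) = 0 := by
        rw [← hrm] at h5
        generalize E (-m + -m) = y at h4 h5
        linear_combination h5 - r * E m * E (-m) * h4
      exact sub_eq_zero.1 ((mul_eq_zero.1 h9).resolve_left (mul_ne_zero h7 hm))
    have h9 : ∀ n : ℕ, (n + 1 : ℕ) < p → E ((n + 1 : ℕ) * m) = r ^ n * E m := by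
      intro n
      induction n with
      | zero => simp
      | succ n ih =>
        intro hn
        have hz : ((n + 1 : ℕ) : ZMod p) ≠ 0 := fun h =>
          Nat.not_dvd_of_pos_of_lt (by omega) (by omega) ((ZMod.natCast_eq_zero_iff _ _).1 h)
        have hz' : ((n + 2 : ℕ) : ZMod p) ≠ 0 := fun h =>
          Nat.not_dvd_of_pos_of_lt (by omega) (by omega) ((ZMod.natCast_eq_zero_iff _ _).1 h)
        rw [show ((n + 1 + 1 : ℕ) : ZMod p) * m = ((n + 1 : ℕ) : ZMod p) * m + m by
          push_cast; ring, h3 _ (mul_ne_zero hz hm0), ih (by omega)]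
        · ring
        · intro h
          refine mul_ne_zero hz' hm0 ?_
          push_cast at h ⊢
          linear_combination h
    have hp2 := (Fact.out : p.Prime).two_le
    have h10 := h9 (p - 2) (by omega)
    rw [show ((p - 2 + 1 : ℕ) : ZMod p) = -1 by
      rw [show p - 2 + 1 = p - 1 by omega, Nat.cast_sub (by omega)]; simp, neg_one_mul] at h10
    have hr0 : r ≠ 0 := fun h => hm (by rw [← h8, h]; ring)
    have h11 : r ^ (p - 1) = 1 := ZMod.pow_card_sub_one_eq_one hr0
    have h12 : r * E (-m) = E m := by
      rw [h10, ← mul_assoc, ← pow_succ', show p - 2 + 1 = p - 1 by omega, h11, one_mul]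
    refine mul_right_cancel₀ hm ?_
    linear_combination h8 - r * h12
  have h7 : ∀ x, x = 0 ∨ E x = E m := by
    refine ZMod.add_induction hm0 (Or.inl rfl) ?_
    rintro x (rfl | hx)
    · right; rw [zero_add]
    · by_cases hx0 : x = 0
      · right; rw [hx0, zero_add]
      by_cases hxm : x = -m
      · left; rw [hxm, neg_add_cancel]
      · right; rw [h3 x hx0 hxm, hr1, one_mul, hx]
  obtain ⟨x, y, hx, hy, hxy⟩ := hE
  exact hxy (((h7 x).resolve_left hx).trans ((h7 y).resolve_left hy).symm)

end TupleAlgebra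

/-! ### Exponents in F_p for elements of order dividing p -/

section ZModPowers

variable {p : ℕ} [Fact p.Prime] {G : Type*} [Group G]

theorem pow_val_add {g : G} (hg : g ^ p = 1) (m n : ZMod p) :
    g ^ (m + n).val = g ^ m.val * g ^ n.val := by
  rw [ZMod.val_add, ← pow_add, ← pow_eq_pow_mod _ hg]

theorem pow_val_mul {g : G} (hg : g ^ p = 1) (m n : ZMod p) :
    g ^ (m * n).val = (g ^ m.val) ^ n.val := by
  rw [ZMod.val_mul, ← pow_mul, ← pow_eq_pow_mod _ hg]

theorem pow_val_one {g : G} : g ^ (1 : ZMod p).val = g := by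
  have := (Fact.out : p.Prime).one_lt
  rw [ZMod.val_one'' this.ne', pow_one]

theorem pow_val_neg {g : G} (hg : g ^ p = 1) (m : ZMod p) : g ^ (-m).val = (g ^ m.val)⁻¹ := by
  rw [eq_inv_iff_mul_eq_one, ← pow_val_add hg, neg_add_cancel, ZMod.val_zero, pow_zero]

end ZModPowers

/-- The third term of the lower central series. -/
abbrev gamma₃ (G : Type*) [Group G] : Subgroup G := ⁅commutator G, ⊤⁆

/-- The fourth term of the lower central series. -/
abbrev gamma₄ (G : Type*) [Group G] : Subgroup G := ⁅gamma₃ G, ⊤⁆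

/-- A group with the self-similarity structure of the GGS-group with defining tuple `E`, where `E`
is extended by `E 0 = 0`. -/
structure GGSData (p : ℕ) [Fact p.Prime] (E : ZMod p → ZMod p) (G : Type*) [Group G] where
  odd : p ≠ 2
  E_zero : E 0 = 0
  E_nonconst : ∃ x y, x ≠ 0 ∧ y ≠ 0 ∧ E x ≠ E y
  /-- The rooted generator. -/
  a : G
  /-- The directed generator. -/
  b : G
  /-- The rotation induced on the first level. -/
  lvl : G → ZMod p
  /-- The sections at the vertices of the first level. -/
  sec : G → ZMod p → G
  lvl_mul : ∀ g h, lvl (g * h) = lvl g + lvl h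
  sec_mul : ∀ g h k, sec (g * h) k = sec g (k + lvl h) * sec h k
  ext_one : ∀ g, lvl g = 0 → (∀ k, sec g k = 1) → g = 1
  lvl_a : lvl a = 1
  lvl_b : lvl b = 0
  sec_a : ∀ k, sec a k = 1
  sec_b : ∀ k, sec b k = if k = 0 then b else a ^ (E k).val
  a_pow : a ^ p = 1
  b_pow : b ^ p = 1
  closure_eq : Subgroup.closure {a, b} = ⊤

/-! ### Sections, generators of the stabilizer, and exponent sums -/

namespace GGSData

variable {p : ℕ} [Fact p.Prime] {E : ZMod p → ZMod p} {G : Type*} [Group G] (D : GGSData p E G)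

/-- The generators have finite order, so every element is a positive word in them and inverses need
no separate treatment. -/
theorem mul_induction {P : G → Prop} (ha : P D.a) (hb : P D.b)
    (hmul : ∀ x y, P x → P y → P (x * y)) (g : G) : P g := by
  have hp := (Fact.out : p.Prime).pos
  have hpow : ∀ x, P x → ∀ n : ℕ, P (x ^ (n + 1)) := by
    intro x hx n
    induction n with
    | zero => simpa using hx
    | succ n ih => rw [pow_succ]; exact hmul _ _ ih hx
  have hone : P 1 := by
    have := hpow _ ha (p - 1)
    rwa [Nat.sub_add_cancel hp, D.a_pow] at this
  have hinv : ∀ x : G, x ^ p = 1 → P x → P x⁻¹ := by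
    intro x hx h
    have hp2 := (Fact.out : p.Prime).two_le
    have : x⁻¹ = x ^ (p - 2 + 1) := by
      rw [inv_eq_iff_mul_eq_one, ← pow_succ', show p - 2 + 1 + 1 = p by omega, hx]
    rw [this]; exact hpow _ h _
  have hmem : g ∈ Subgroup.closure {D.a, D.b} := D.closure_eq ▸ Subgroup.mem_top g
  refine (Subgroup.closure_induction (p := fun g _ => P g ∧ P g⁻¹) ?_ ?_ ?_ ?_ hmem).1
  · rintro x (rfl | rfl)
    · exact ⟨ha, hinv _ D.a_pow ha⟩
    · exact ⟨hb, hinv _ D.b_pow hb⟩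
  · simpa using hone
  · rintro x y _ _ ⟨h1, h2⟩ ⟨h3, h4⟩
    exact ⟨hmul _ _ h1 h3, by rw [mul_inv_rev]; exact hmul _ _ h4 h2⟩
  · rintro x _ ⟨h1, h2⟩
    exact ⟨h2, by rwa [inv_inv]⟩

theorem lvl_one : D.lvl 1 = 0 := by simpa using D.lvl_mul 1 1

theorem lvl_inv (g : G) : D.lvl g⁻¹ = -D.lvl g := by
  rw [eq_neg_iff_add_eq_zero, ← D.lvl_mul, inv_mul_cancel, lvl_one]

theorem lvl_pow (g : G) (n : ℕ) : D.lvl (g ^ n) = n * D.lvl g := by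
  induction n with
  | zero => simp [lvl_one]
  | succ n ih => rw [pow_succ, D.lvl_mul, ih]; push_cast; ring

theorem lvl_a_pow_val (n : ZMod p) : D.lvl (D.a ^ n.val) = n := by
  rw [lvl_pow, lvl_a, mul_one, ZMod.natCast_zmod_val]

theorem lvl_commutator (g h : G) : D.lvl ⁅g, h⁆ = 0 := by
  simp only [commutatorElement_def, D.lvl_mul, lvl_inv]; ring

theorem lvl_conj (g h : G) : D.lvl (h * g * h⁻¹) = D.lvl g := by
  simp only [D.lvl_mul, lvl_inv]; ring

theorem sec_one (k : ZMod p) : D.sec 1 k = 1 := by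
  simpa [lvl_one] using D.sec_mul 1 1 k

theorem sec_inv (g : G) (k : ZMod p) : D.sec g⁻¹ k = (D.sec g (k - D.lvl g))⁻¹ := by
  have := D.sec_mul g⁻¹ g (k - D.lvl g)
  rw [inv_mul_cancel, sec_one, sub_add_cancel] at this
  exact eq_inv_of_mul_eq_one_left this.symm

theorem sec_mul_of_lvl (g : G) {h : G} (hh : D.lvl h = 0) (k : ZMod p) :
    D.sec (g * h) k = D.sec g k * D.sec h k := by rw [D.sec_mul, hh, add_zero]

theorem sec_inv_of_lvl {g : G} (hg : D.lvl g = 0) (k : ZMod p) :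
    D.sec g⁻¹ k = (D.sec g k)⁻¹ := by rw [sec_inv, hg, sub_zero]

theorem sec_commutator {g h : G} (hg : D.lvl g = 0) (hh : D.lvl h = 0) (k : ZMod p) :
    D.sec ⁅g, h⁆ k = ⁅D.sec g k, D.sec h k⁆ := by
  have hg' : D.lvl g⁻¹ = 0 := by rw [lvl_inv, hg, neg_zero]
  have hh' : D.lvl h⁻¹ = 0 := by rw [lvl_inv, hh, neg_zero]
  simp only [commutatorElement_def]
  rw [D.sec_mul_of_lvl _ hh', D.sec_mul_of_lvl _ hg', D.sec_mul_of_lvl _ hh,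
    D.sec_inv_of_lvl hg, D.sec_inv_of_lvl hh]

theorem sec_pow {g : G} (hg : D.lvl g = 0) (n : ℕ) (k : ZMod p) :
    D.sec (g ^ n) k = D.sec g k ^ n := by
  induction n with
  | zero => simp [sec_one]
  | succ n ih => rw [pow_succ, D.sec_mul_of_lvl _ hg, ih, pow_succ]

theorem sec_conj {g : G} (hg : D.lvl g = 0) (h : G) (k : ZMod p) :
    D.sec (h * g * h⁻¹) k =
      D.sec h (k - D.lvl h) * D.sec g (k - D.lvl h) * (D.sec h (k - D.lvl h))⁻¹ := by
  rw [D.sec_mul, D.sec_mul, sec_inv, lvl_inv, hg, add_zero, sub_eq_add_neg]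

theorem sec_a_pow (n : ℕ) (k : ZMod p) : D.sec (D.a ^ n) k = 1 := by
  induction n generalizing k with
  | zero => simp [sec_one]
  | succ n ih => rw [pow_succ, D.sec_mul, ih, sec_a, one_mul]

theorem eq_of_sec_eq {g h : G} (hl : D.lvl g = D.lvl h) (hs : ∀ k, D.sec g k = D.sec h k) :
    g = h := by
  refine mul_inv_eq_one.1 (D.ext_one _ ?_ fun k => ?_)
  · rw [D.lvl_mul, lvl_inv, hl, add_neg_cancel]
  · rw [D.sec_mul, sec_inv, lvl_inv, hs, ← sub_eq_add_neg, mul_inv_cancel]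

/-- The conjugate of `b` by `a ^ i`. -/
def conjB (i : ZMod p) : G := D.a ^ i.val * D.b * (D.a ^ i.val)⁻¹

theorem lvl_conjB (i : ZMod p) : D.lvl (D.conjB i) = 0 := by rw [conjB, lvl_conj, lvl_b]

theorem sec_conjB (i k : ZMod p) :
    D.sec (D.conjB i) k = if k = i then D.b else D.a ^ (E (k - i)).val := by
  rw [conjB, D.sec_conj D.lvl_b, sec_a_pow, lvl_a_pow_val, one_mul, inv_one, mul_one, sec_b]
  simp only [sub_eq_zero]

theorem sec_conjB_self (i : ZMod p) : D.sec (D.conjB i) i = D.b := by simp [sec_conjB]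

theorem sec_conjB_of_ne {i k : ZMod p} (h : k ≠ i) :
    D.sec (D.conjB i) k = D.a ^ (E (k - i)).val := by simp [sec_conjB, h]

theorem conjB_zero : D.conjB 0 = D.b := by simp [conjB]

theorem conjB_pow (i : ZMod p) : D.conjB i ^ p = 1 := by
  rw [conjB, conj_pow, D.b_pow, mul_one, mul_inv_cancel]

theorem a_mul_conjB (i : ZMod p) : D.a * D.conjB i * D.a⁻¹ = D.conjB (i + 1) := by
  rw [conjB, conjB, pow_val_add D.a_pow, pow_val_one, ← pow_succ, pow_succ']
  group

/-- The closure is normalized by a, so every element is s a^n with s in it; level 0 forces p to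
divide n. -/
theorem mem_closure_conjB {g : G} (hg : D.lvl g = 0) :
    g ∈ Subgroup.closure (Set.range D.conjB) := by
  set C := Subgroup.closure (Set.range D.conjB) with hC
  have hconj : ∀ s ∈ C, D.a * s * D.a⁻¹ ∈ C := by
    intro s hs
    have : C.map (MulAut.conj D.a).toMonoidHom ≤ C := by
      rw [hC, MonoidHom.map_closure, Subgroup.closure_le]
      rintro _ ⟨_, ⟨i, rfl⟩, rfl⟩
      refine Subgroup.subset_closure ⟨i + 1, ?_⟩
      rw [← a_mul_conjB]; rfl
    exact this ⟨s, hs, rfl⟩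
  have key : ∀ x g : G, (∃ s ∈ C, ∃ n : ℕ, g = s * D.a ^ n) → ∃ s ∈ C, ∃ n : ℕ, x * g = s * D.a ^ n := by
    refine D.mul_induction ?_ ?_ ?_
    · rintro _ ⟨s, hs, n, rfl⟩
      exact ⟨_, hconj s hs, n + 1, by rw [pow_succ']; group⟩
    · rintro _ ⟨s, hs, n, rfl⟩
      refine ⟨D.b * s, C.mul_mem (Subgroup.subset_closure ⟨0, D.conjB_zero⟩) hs, n, by group⟩
    · intro x y hx hy g hg
      rw [mul_assoc]
      exact hx _ (hy _ hg)
  obtain ⟨s, hs, n, hn⟩ := key g 1 ⟨1, C.one_mem, 0, by simp⟩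
  rw [mul_one] at hn
  have hs0 : D.lvl s = 0 := by
    refine Subgroup.closure_induction (p := fun s _ => D.lvl s = 0) ?_ D.lvl_one ?_ ?_ hs
    · rintro _ ⟨i, rfl⟩; exact D.lvl_conjB i
    · intro x y _ _ hx hy; rw [D.lvl_mul, hx, hy, add_zero]
    · intro x _ hx; rw [lvl_inv, hx, neg_zero]
  have : (n : ZMod p) = 0 := by
    rw [hn, D.lvl_mul, hs0, lvl_pow, lvl_a, zero_add, mul_one] at hg
    exact hg
  obtain ⟨m, rfl⟩ := (ZMod.natCast_eq_zero_iff n p).1 this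
  rw [hn, pow_mul, D.a_pow, one_pow, mul_one]
  exact hs

theorem stab_induction {P : G → Prop} (hb : ∀ i, P (D.conjB i))
    (hmul : ∀ x y, D.lvl x = 0 → D.lvl y = 0 → P x → P y → P (x * y)) {g : G}
    (hg : D.lvl g = 0) : P g := by
  have hp := (Fact.out : p.Prime).two_le
  have hl : ∀ (i : ZMod p) (n : ℕ), D.lvl (D.conjB i ^ n) = 0 := fun i n => by
    rw [lvl_pow, lvl_conjB, mul_zero]
  have hpow : ∀ (i : ZMod p) (n : ℕ), P (D.conjB i ^ (n + 1)) := by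
    intro i n
    induction n with
    | zero => simpa using hb i
    | succ n ih => rw [pow_succ]; exact hmul _ _ (hl _ _) (D.lvl_conjB i) ih (hb i)
  refine (Subgroup.closure_induction (p := fun g _ => (D.lvl g = 0 ∧ P g) ∧ P g⁻¹) ?_ ?_ ?_ ?_
    (D.mem_closure_conjB hg)).1.2
  · rintro _ ⟨i, rfl⟩
    refine ⟨⟨D.lvl_conjB i, hb i⟩, ?_⟩
    have : (D.conjB i)⁻¹ = D.conjB i ^ (p - 2 + 1) := by
      rw [inv_eq_iff_mul_eq_one, ← pow_succ', show p - 2 + 1 + 1 = p by omega, conjB_pow]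
    rw [this]; exact hpow _ _
  · have := hpow 0 (p - 1)
    rw [show p - 1 + 1 = p by omega, conjB_pow] at this
    simpa [lvl_one] using this
  · rintro x y _ _ ⟨⟨h1, h2⟩, h3⟩ ⟨⟨h4, h5⟩, h6⟩
    refine ⟨⟨by rw [D.lvl_mul, h1, h4, add_zero], hmul _ _ h1 h4 h2 h5⟩, ?_⟩
    rw [mul_inv_rev]
    exact hmul _ _ (by rw [lvl_inv, h4, neg_zero]) (by rw [lvl_inv, h1, neg_zero]) h6 h3
  · rintro x _ ⟨⟨h1, h2⟩, h3⟩
    exact ⟨⟨by rw [lvl_inv, h1, neg_zero], h3⟩, by rwa [inv_inv]⟩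

include D in
theorem E_ne_zero : E ≠ 0 := by
  rintro rfl
  obtain ⟨x, y, -, -, h⟩ := D.E_nonconst
  exact h rfl

/-- Weights whose correlation with `E` is constantly `1`. -/
noncomputable def corr : ZMod p → ZMod p := (exists_correlation_eq_one D.E_ne_zero).choose

theorem sum_corr (t : ZMod p) : ∑ k, D.corr k * E (k + t) = 1 :=
  (exists_correlation_eq_one D.E_ne_zero).choose_spec t

/-- The exponent sum of `b`, as a weighted sum of the rotations at the first level. -/
noncomputable def bexp (g : G) : ZMod p := ∑ k, D.corr k * D.lvl (D.sec g k)

theorem lvl_sec_b (k : ZMod p) : D.lvl (D.sec D.b k) = E k := by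
  rw [sec_b]
  split_ifs with h
  · rw [h, lvl_b, D.E_zero]
  · exact D.lvl_a_pow_val _

/-- A factor on the right shifts the sections cyclically. The weights are chosen so that such shifts
do not matter, which makes `bexp` additive. -/
theorem bexp_shift (g : G) (t : ZMod p) :
    ∑ k, D.corr k * D.lvl (D.sec g (k + t)) = D.bexp g := by
  rw [bexp]
  revert t
  refine D.mul_induction (P := fun g => ∀ t, ∑ k, D.corr k * D.lvl (D.sec g (k + t)) =
    ∑ k, D.corr k * D.lvl (D.sec g k)) ?_ ?_ ?_ g
  · intro t; simp [sec_a]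
  · intro t
    simp only [lvl_sec_b, sum_corr]
    simpa using (D.sum_corr 0).symm
  · intro x y hx hy t
    simp only [D.sec_mul, D.lvl_mul, mul_add, Finset.sum_add_distrib, add_assoc, hx, hy]

theorem bexp_mul (g h : G) : D.bexp (g * h) = D.bexp g + D.bexp h := by
  rw [bexp]
  simp only [D.sec_mul, D.lvl_mul, mul_add, Finset.sum_add_distrib, bexp_shift]
  rfl

theorem bexp_a : D.bexp D.a = 0 := by simp [bexp, sec_a, lvl_one]

theorem bexp_b : D.bexp D.b = 1 := by
  simp only [bexp, lvl_sec_b]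
  simpa using D.sum_corr 0

theorem bexp_one : D.bexp 1 = 0 := by simpa using D.bexp_mul 1 1

theorem bexp_inv (g : G) : D.bexp g⁻¹ = -D.bexp g := by
  rw [eq_neg_iff_add_eq_zero, ← bexp_mul, inv_mul_cancel, bexp_one]

theorem bexp_pow (g : G) (n : ℕ) : D.bexp (g ^ n) = n * D.bexp g := by
  induction n with
  | zero => simp [bexp_one]
  | succ n ih => rw [pow_succ, bexp_mul, ih]; push_cast; ring

theorem bexp_a_pow (n : ℕ) : D.bexp (D.a ^ n) = 0 := by rw [bexp_pow, bexp_a, mul_zero]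

theorem bexp_commutator (g h : G) : D.bexp ⁅g, h⁆ = 0 := by
  simp only [commutatorElement_def, bexp_mul, bexp_inv]; ring

theorem bexp_conj (g h : G) : D.bexp (h * g * h⁻¹) = D.bexp g := by
  simp only [bexp_mul, bexp_inv]; ring

theorem bexp_conjB (i : ZMod p) : D.bexp (D.conjB i) = 1 := by rw [conjB, bexp_conj, bexp_b]

theorem bexp_sec_conjB (i k : ZMod p) :
    D.bexp (D.sec (D.conjB i) k) = if k = i then 1 else 0 := by
  rw [sec_conjB]
  split_ifs
  · exact D.bexp_b
  · exact D.bexp_a_pow _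

theorem lvl_sec_conjB (i k : ZMod p) : D.lvl (D.sec (D.conjB i) k) = E (k - i) := by
  rw [sec_conjB]
  split_ifs with h
  · rw [h, lvl_b, sub_self, D.E_zero]
  · exact D.lvl_a_pow_val _

theorem sum_sec_mul {f : G → ZMod p} (hf : ∀ g h, f (g * h) = f g + f h) (g h : G) :
    ∑ k, f (D.sec (g * h) k) = ∑ k, f (D.sec g k) + ∑ k, f (D.sec h k) := by
  simp only [D.sec_mul, hf, Finset.sum_add_distrib]
  congr 1
  exact Fintype.sum_equiv (Equiv.addRight (D.lvl h)) _ _ fun k => rfl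

/-- Among the sections of b exactly one is b and the others are powers of a. -/
theorem sum_bexp_sec (g : G) : ∑ k, D.bexp (D.sec g k) = D.bexp g := by
  refine D.mul_induction (P := fun g => ∑ k, D.bexp (D.sec g k) = D.bexp g) ?_ ?_ ?_ g
  · simp [sec_a, bexp_a, bexp_one]
  · have := D.bexp_sec_conjB 0
    rw [conjB_zero] at this
    simp [this, bexp_b]
  · intro x y hx hy
    rw [D.sum_sec_mul D.bexp_mul, hx, hy, bexp_mul]

/-- The exponent of `⁅a, b⁆` modulo the third term of the lower central series. -/
noncomputable def theta (g : G) : ZMod p := ∑ k, k * D.bexp (D.sec g k)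

/-- Shifting the positions of the sections of g by the level of h lowers the weights by `D.lvl h`,
and the b-exponents of these sections add up to `D.bexp g`. -/
theorem theta_mul (g h : G) :
    D.theta (g * h) = D.theta g - D.lvl h * D.bexp g + D.theta h := by
  simp only [theta, D.sec_mul, bexp_mul, mul_add, Finset.sum_add_distrib]
  congr 1
  rw [← D.sum_bexp_sec g, Finset.mul_sum, ← Finset.sum_sub_distrib]
  refine Fintype.sum_equiv (Equiv.addRight (D.lvl h)) _ _ fun k => ?_
  simp only [Equiv.coe_addRight]; ring

theorem theta_one : D.theta 1 = 0 := by simp [theta, sec_one, bexp_one]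

theorem theta_commutator (g h : G) :
    D.theta ⁅g, h⁆ = D.lvl g * D.bexp h - D.lvl h * D.bexp g := by
  have h1 : ⁅g, h⁆ * (h * g) = g * h := by rw [commutatorElement_def]; group
  have h2 := congrArg D.theta h1
  rw [D.theta_mul, D.theta_mul, D.theta_mul, bexp_commutator] at h2
  linear_combination h2

theorem theta_conjB (i : ZMod p) : D.theta (D.conjB i) = i := by
  simp [theta, bexp_sec_conjB]

/-- Both sides are additive on the stabilizer and agree on the b_i. Thus the b-exponents of the
sections determine their rotations, as a convolution with E. -/
theorem lvl_sec_eq_sum {g : G} (hg : D.lvl g = 0) (k : ZMod p) :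
    D.lvl (D.sec g k) = ∑ i, E (k - i) * D.bexp (D.sec g i) := by
  refine D.stab_induction (P := fun g => D.lvl (D.sec g k) =
    ∑ i, E (k - i) * D.bexp (D.sec g i)) ?_ ?_ hg
  · intro i
    simp [lvl_sec_conjB, bexp_sec_conjB]
  · intro x y _ hy h1 h2
    simp only [D.sec_mul_of_lvl _ hy, D.lvl_mul, bexp_mul, mul_add, Finset.sum_add_distrib, h1, h2]

end GGSData

/-! ### The quotients G/G', G'/γ₃(G) and K/K' -/

namespace GGSData

variable {p : ℕ} [Fact p.Prime] {E : ZMod p → ZMod p} {G : Type*} [Group G] (D : GGSData p E G)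

/-- The stabilizer of the first level. -/
def stab : Subgroup G where
  carrier := {g | D.lvl g = 0}
  mul_mem' {g h} hg hh := by
    rw [Set.mem_ofPred_eq] at *
    rw [D.lvl_mul, hg, hh, add_zero]
  one_mem' := D.lvl_one
  inv_mem' {g} hg := by
    rw [Set.mem_ofPred_eq] at *
    rw [D.lvl_inv, hg, neg_zero]

theorem mem_stab {g : G} : g ∈ D.stab ↔ D.lvl g = 0 := Iff.rfl

theorem conjB_mem_stab (i : ZMod p) : D.conjB i ∈ D.stab := D.lvl_conjB i

instance : D.stab.Normal := ⟨fun g hg h => by rw [mem_stab, lvl_conj]; exact hg⟩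

theorem commutator_le_stab : commutator G ≤ D.stab := by
  rw [commutator_def, Subgroup.commutator_le]
  exact fun g _ h _ => D.lvl_commutator g h

/-- The exponent sums of both generators, as a homomorphism. -/
noncomputable def exponents : G →* Multiplicative (ZMod p × ZMod p) where
  toFun g := Multiplicative.ofAdd (D.lvl g, D.bexp g)
  map_one' := by rw [lvl_one, bexp_one]; rfl
  map_mul' g h := by rw [D.lvl_mul, bexp_mul]; rfl

/-- The abelianization is generated by the images of a and b, whose orders divide p, so the two
exponents determine the image of an element. -/
theorem mem_commutator_iff {g : G} : g ∈ commutator G ↔ D.lvl g = 0 ∧ D.bexp g = 0 := by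
  constructor
  · intro hg
    have hle : commutator G ≤ D.exponents.ker := Abelianization.commutator_subset_ker _
    have := hle hg
    rw [MonoidHom.mem_ker] at this
    exact Prod.mk.inj (Multiplicative.ofAdd.injective this)
  · rintro ⟨h1, h2⟩
    have ha : (Abelianization.of D.a) ^ p = 1 := by rw [← map_pow, D.a_pow, map_one]
    have hb : (Abelianization.of D.b) ^ p = 1 := by rw [← map_pow, D.b_pow, map_one]
    have key : ∀ g : G, Abelianization.of g =
        Abelianization.of D.a ^ (D.lvl g).val * Abelianization.of D.b ^ (D.bexp g).val := by
      refine D.mul_induction ?_ ?_ ?_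
      · rw [lvl_a, bexp_a, pow_val_one, ZMod.val_zero, pow_zero, mul_one]
      · rw [lvl_b, bexp_b, pow_val_one, ZMod.val_zero, pow_zero, one_mul]
      · intro x y hx hy
        rw [map_mul, hx, hy, D.lvl_mul, bexp_mul, pow_val_add ha, pow_val_add hb]
        exact mul_mul_mul_comm _ _ _ _
    rw [← Abelianization.ker_of, MonoidHom.mem_ker, key, h1, h2]
    simp

include D in
theorem index_commutator : (commutator G).index = p ^ 2 := by
  have hk : commutator G = D.exponents.ker := by
    ext g
    rw [D.mem_commutator_iff, MonoidHom.mem_ker]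
    exact ⟨fun h => by rw [exponents]; exact congrArg Multiplicative.ofAdd (Prod.ext h.1 h.2),
      fun h => Prod.mk.inj (Multiplicative.ofAdd.injective h)⟩
  have hs : D.exponents.range = ⊤ := by
    rw [MonoidHom.range_eq_top]
    intro x
    refine ⟨D.a ^ (x.toAdd.1).val * D.b ^ (x.toAdd.2).val, ?_⟩
    refine congrArg Multiplicative.ofAdd (Prod.ext ?_ ?_)
    · simp [D.lvl_mul, lvl_pow, lvl_a, lvl_b]; rfl
    · simp [bexp_mul, bexp_pow, bexp_a, bexp_b]; rfl
  rw [hk, Subgroup.index_ker, hs, Subgroup.card_top]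
  change Nat.card (ZMod p × ZMod p) = _
  rw [Nat.card_prod, Nat.card_zmod, sq]

/-- The b-exponent of the section at k counts the occurrences of b_k, and the b_k generate the
stabilizer with orders dividing p. -/
theorem mem_commutator_stab_iff {g : G} :
    g ∈ ⁅D.stab, D.stab⁆ ↔ D.lvl g = 0 ∧ ∀ k, D.bexp (D.sec g k) = 0 := by
  constructor
  · intro hg
    refine ⟨D.commutator_le_stab (Subgroup.commutator_mono le_top le_top hg), ?_⟩
    suffices h : D.lvl g = 0 ∧ ∀ k, D.bexp (D.sec g k) = 0 from h.2
    rw [Subgroup.commutator_def] at hg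
    refine Subgroup.closure_induction (p := fun g _ => D.lvl g = 0 ∧ ∀ k, D.bexp (D.sec g k) = 0)
      ?_ ?_ ?_ ?_ hg
    · rintro _ ⟨x, hx, y, hy, rfl⟩
      exact ⟨D.lvl_commutator _ _, fun k => by rw [D.sec_commutator hx hy, bexp_commutator]⟩
    · exact ⟨D.lvl_one, fun k => by rw [sec_one, bexp_one]⟩
    · rintro x y _ _ ⟨h1, h2⟩ ⟨h3, h4⟩
      exact ⟨by rw [D.lvl_mul, h1, h3, add_zero],
        fun k => by rw [D.sec_mul_of_lvl _ h3, bexp_mul, h2, h4, add_zero]⟩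
    · rintro x _ ⟨h1, h2⟩
      exact ⟨by rw [lvl_inv, h1, neg_zero],
        fun k => by rw [D.sec_inv_of_lvl h1, bexp_inv, h2, neg_zero]⟩
  · rintro ⟨hg, h⟩
    have key : ∃ h : g ∈ D.stab, Abelianization.of (⟨g, h⟩ : D.stab) =
        ∏ k, Abelianization.of (⟨D.conjB k, D.conjB_mem_stab k⟩ : D.stab) ^
          (D.bexp (D.sec g k)).val := by
      have hpow : ∀ k, Abelianization.of (⟨D.conjB k, D.conjB_mem_stab k⟩ : D.stab) ^ p = 1 := by
        intro k
        rw [← map_pow, SubmonoidClass.mk_pow]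
        simp only [conjB_pow]
        exact map_one _
      refine D.stab_induction (P := fun g => ∃ h : g ∈ D.stab, Abelianization.of
        (⟨g, h⟩ : D.stab) = ∏ k, Abelianization.of (⟨D.conjB k, D.conjB_mem_stab k⟩ : D.stab) ^
          (D.bexp (D.sec g k)).val) ?_ ?_ hg
      · intro i
        refine ⟨D.lvl_conjB i, ?_⟩
        rw [Finset.prod_eq_single i]
        · rw [bexp_sec_conjB, if_pos rfl, pow_val_one]
        · intro k _ hk
          rw [bexp_sec_conjB, if_neg hk, ZMod.val_zero, pow_zero]
        · intro hi; exact absurd (Finset.mem_univ _) hi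
      · rintro x y hx hy ⟨_, h1⟩ ⟨_, h2⟩
        refine ⟨D.stab.mul_mem hx hy, ?_⟩
        rw [← MulMemClass.mk_mul_mk _ x y hx hy, map_mul, h1, h2, ← Finset.prod_mul_distrib]
        refine Finset.prod_congr rfl fun k _ => ?_
        rw [D.sec_mul_of_lvl _ hy, bexp_mul, pow_val_add (hpow k)]
    obtain ⟨hg', hk⟩ := key
    simp only [h, ZMod.val_zero, pow_zero, Finset.prod_const_one] at hk
    rw [← MonoidHom.mem_ker, Abelianization.ker_of] at hk
    rw [← Subgroup.map_subtype_commutator]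
    exact ⟨_, hk, rfl⟩

theorem sec_mem_commutator {g : G} (hg : g ∈ ⁅D.stab, D.stab⁆) (k : ZMod p) :
    D.sec g k ∈ commutator G := by
  obtain ⟨h1, h2⟩ := D.mem_commutator_stab_iff.1 hg
  rw [D.mem_commutator_iff]
  refine ⟨?_, h2 k⟩
  rw [D.lvl_sec_eq_sum h1]
  simp [h2]

/-- The commutator of the generators. -/
def c : G := ⁅D.a, D.b⁆

theorem c_mem : D.c ∈ commutator G := by
  rw [commutator_def]
  exact Subgroup.commutator_mem_commutator (Subgroup.mem_top _) (Subgroup.mem_top _)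

theorem theta_c : D.theta D.c = 1 := by
  rw [c, theta_commutator, lvl_a, bexp_b, lvl_b, zero_mul, sub_zero, one_mul]

theorem theta_mul_of_mem {g h : G} (hh : h ∈ commutator G) :
    D.theta (g * h) = D.theta g + D.theta h := by
  rw [theta_mul, (D.mem_commutator_iff.1 hh).1, zero_mul, sub_zero]

section Central

variable {Q : Type*} [Group Q] (f : G →* Q) (hf : ∀ q, Commute (f D.c) q)
include hf

theorem map_conjB (i : ZMod p) : f (D.conjB i) = f D.c ^ i.val * f D.b := by
  have key : ∀ n : ℕ, f (D.a ^ n * D.b * (D.a ^ n)⁻¹) = f D.c ^ n * f D.b := by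
    intro n
    induction n with
    | zero => simp
    | succ n ih =>
      have h1 : D.a ^ (n + 1) * D.b * (D.a ^ (n + 1))⁻¹ =
          D.a * (D.a ^ n * D.b * (D.a ^ n)⁻¹) * D.a⁻¹ := by rw [pow_succ']; group
      have h2 : D.a * D.b * D.a⁻¹ = D.c * D.b := by rw [c, commutatorElement_def]; group
      have h3 := congrArg f h2
      simp only [map_mul, map_inv] at h3
      rw [h1, map_mul, map_mul, ih, map_inv, ← mul_assoc, ← ((hf (f D.a)).pow_left n).eq,
        mul_assoc, mul_assoc, ← mul_assoc (f D.a), h3, ← mul_assoc, pow_succ]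
  exact key _

/-- Each conjugation by a multiplies the image of b by the central element `f D.c`; p conjugations
return to b. The representative p - 1 of -1 is the last step of this cycle. -/
theorem map_c_pow : f D.c ^ p = 1 := by
  have h := D.map_conjB f hf (-1)
  have h2 := congrArg f (D.a_mul_conjB (-1))
  rw [neg_add_cancel, conjB_zero, map_mul, map_mul, map_inv, h] at h2
  have h3 : f D.a * f D.b * (f D.a)⁻¹ = f D.c * f D.b := by
    rw [c, map_commutatorElement, commutatorElement_def]; group
  rw [← mul_assoc, ← ((hf (f D.a)).pow_left _).eq, mul_assoc, mul_assoc, ← mul_assoc (f D.a), h3,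
    ← mul_assoc, ← pow_succ] at h2
  have h4 : (-1 : ZMod p).val + 1 = p := by
    have := ZMod.val_neg_one (p - 1)
    have hp := (Fact.out : p.Prime).pos
    rw [Nat.succ_eq_add_one] at this
    have h5 : (-1 : ZMod p).val = p - 1 := by
      rw [ZMod.neg_val, if_neg one_ne_zero, ZMod.val_one]
    omega
  rw [h4] at h2
  exact mul_eq_right.1 h2

theorem map_eq_of_stab {g : G} (hg : D.lvl g = 0) :
    f g = f D.c ^ (D.theta g).val * f D.b ^ (D.bexp g).val := by
  have hb : f D.b ^ p = 1 := by rw [← map_pow, D.b_pow, map_one]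
  refine D.stab_induction (P := fun g => f g = f D.c ^ (D.theta g).val *
    f D.b ^ (D.bexp g).val) ?_ ?_ hg
  · intro i
    rw [D.map_conjB f hf, theta_conjB, bexp_conjB, pow_val_one]
  · intro x y hx hy h1 h2
    rw [map_mul, h1, h2, theta_mul, hy, zero_mul, sub_zero, bexp_mul,
      pow_val_add (D.map_c_pow f hf), pow_val_add hb, mul_assoc, mul_assoc]
    congr 1
    rw [← mul_assoc, ← ((hf (f D.b ^ (D.bexp x).val)).pow_left _).eq, mul_assoc]

end Central

theorem commute_mk_of_mem {N K : Subgroup G} [N.Normal] (h : ⁅K, ⊤⁆ ≤ N) {x : G} (hx : x ∈ K)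
    (q : G ⧸ N) : Commute (QuotientGroup.mk' N x) q := by
  obtain ⟨g, rfl⟩ := QuotientGroup.mk'_surjective N q
  rw [commute_iff_eq, ← commutatorElement_eq_one_iff_mul_comm, ← map_commutatorElement,
    ← MonoidHom.mem_ker, QuotientGroup.ker_mk']
  exact h (Subgroup.commutator_mem_commutator hx (Subgroup.mem_top _))

/-- Modulo γ₃ the commutator c is central, so an element of the stabilizer is c^θ b^β with the
exponents `theta` and `bexp`. -/
theorem mem_gamma₃_iff {g : G} :
    g ∈ gamma₃ G ↔ D.lvl g = 0 ∧ D.bexp g = 0 ∧ D.theta g = 0 := by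
  constructor
  · intro hg
    suffices h : g ∈ commutator G ∧ D.theta g = 0 by
      have := D.mem_commutator_iff.1 h.1
      exact ⟨this.1, this.2, h.2⟩
    rw [gamma₃, Subgroup.commutator_def] at hg
    refine Subgroup.closure_induction (p := fun g _ => g ∈ commutator G ∧ D.theta g = 0)
      ?_ ?_ ?_ ?_ hg
    · rintro _ ⟨x, hx, y, hy, rfl⟩
      rw [theta_commutator, (D.mem_commutator_iff.1 hx).1, (D.mem_commutator_iff.1 hx).2]
      refine ⟨D.mem_commutator_iff.2 ⟨D.lvl_commutator _ _, D.bexp_commutator _ _⟩, by simp⟩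
    · exact ⟨one_mem _, D.theta_one⟩
    · rintro x y _ _ ⟨h1, h2⟩ ⟨h3, h4⟩
      exact ⟨mul_mem h1 h3, by rw [D.theta_mul_of_mem h3, h2, h4, add_zero]⟩
    · rintro x _ ⟨h1, h2⟩
      refine ⟨inv_mem h1, ?_⟩
      have := D.theta_mul_of_mem (g := x⁻¹) h1
      rw [inv_mul_cancel, theta_one, h2, add_zero] at this
      exact this.symm
  · rintro ⟨h1, h2, h3⟩
    have := D.map_eq_of_stab (QuotientGroup.mk' (gamma₃ G))
      (commute_mk_of_mem le_rfl D.c_mem) h1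
    rw [h2, h3, ZMod.val_zero, pow_zero, pow_zero, one_mul, ← MonoidHom.mem_ker,
      QuotientGroup.ker_mk'] at this
    exact this

theorem gamma₃_le_commutator (G : Type*) [Group G] : gamma₃ G ≤ commutator G :=
  Subgroup.commutator_le_left _ _

include D in
theorem relIndex_gamma₃ : (gamma₃ G).relIndex (commutator G) = p := by
  let f : commutator G →* Multiplicative (ZMod p) :=
    { toFun := fun g => Multiplicative.ofAdd (D.theta g)
      map_one' := by rw [Subgroup.coe_one, theta_one]; rfl
      map_mul' := fun g h => by rw [Subgroup.coe_mul, D.theta_mul_of_mem h.2]; rfl }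
  have hk : (gamma₃ G).subgroupOf (commutator G) = f.ker := by
    ext g
    rw [Subgroup.mem_subgroupOf, D.mem_gamma₃_iff, MonoidHom.mem_ker]
    have hg := D.mem_commutator_iff.1 g.2
    exact ⟨fun h => congrArg Multiplicative.ofAdd h.2.2,
      fun h => ⟨hg.1, hg.2, Multiplicative.ofAdd.injective h⟩⟩
  have hs : f.range = ⊤ := by
    rw [MonoidHom.range_eq_top]
    intro x
    refine ⟨⟨D.c, D.c_mem⟩ ^ x.toAdd.val, ?_⟩
    rw [map_pow]
    change Multiplicative.ofAdd (D.theta D.c) ^ _ = x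
    rw [theta_c, ← ofAdd_nsmul, nsmul_one, ZMod.natCast_zmod_val]
    rfl
  rw [Subgroup.relIndex, hk, Subgroup.index_ker, hs, Subgroup.card_top]
  exact Nat.card_zmod p

include D in
theorem index_gamma₃ : (gamma₃ G).index = p ^ 3 := by
  rw [← Subgroup.relIndex_mul_index (gamma₃_le_commutator G), D.relIndex_gamma₃,
    D.index_commutator]
  ring

theorem index_stab : D.stab.index = p := by
  let f : G →* Multiplicative (ZMod p) :=
    { toFun := fun g => Multiplicative.ofAdd (D.lvl g)
      map_one' := by rw [lvl_one]; rfl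
      map_mul' := fun g h => by rw [D.lvl_mul]; rfl }
  have hk : D.stab = f.ker := rfl
  have hs : f.range = ⊤ := by
    rw [MonoidHom.range_eq_top]
    exact fun x => ⟨D.a ^ x.toAdd.val, congrArg Multiplicative.ofAdd (D.lvl_a_pow_val _)⟩
  rw [hk, Subgroup.index_ker, hs, Subgroup.card_top]
  exact Nat.card_zmod p

theorem relIndex_commutator_stab : ⁅D.stab, D.stab⁆.relIndex D.stab = p ^ p := by
  let f : D.stab →* (ZMod p → Multiplicative (ZMod p)) :=
    { toFun := fun g k => Multiplicative.ofAdd (D.bexp (D.sec g k))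
      map_one' := funext fun k => by rw [Subgroup.coe_one, sec_one, bexp_one]; rfl
      map_mul' := fun g h => funext fun k => by
        rw [Subgroup.coe_mul, D.sec_mul_of_lvl _ h.2, bexp_mul]; rfl }
  have hk : ⁅D.stab, D.stab⁆.subgroupOf D.stab = f.ker := by
    ext g
    rw [Subgroup.mem_subgroupOf, D.mem_commutator_stab_iff, MonoidHom.mem_ker]
    exact ⟨fun h => funext fun k => congrArg Multiplicative.ofAdd (h.2 k),
      fun h => ⟨g.2, fun k => Multiplicative.ofAdd.injective (congrFun h k)⟩⟩
  have hs : f.range = ⊤ := by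
    refine top_le_iff.1 fun x _ => ?_
    rw [← Finset.univ_prod_mulSingle x]
    refine Subgroup.prod_mem _ fun k _ => ⟨⟨D.conjB k, D.conjB_mem_stab k⟩ ^ (x k).toAdd.val, ?_⟩
    rw [map_pow]
    funext j
    change (Multiplicative.ofAdd (D.bexp (D.sec (D.conjB k) j))) ^ _ = _
    rw [bexp_sec_conjB, Pi.mulSingle_apply]
    split_ifs with h
    · rw [← ofAdd_nsmul, nsmul_one, ZMod.natCast_zmod_val]; subst h; rfl
    · rw [ofAdd_zero, one_pow]
  rw [Subgroup.relIndex, hk, Subgroup.index_ker, hs, Subgroup.card_top, Nat.card_pi]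
  change ∏ k : ZMod p, Nat.card (ZMod p) = _
  simp

end GGSData

/-! ### Rigid stabilizers: γ₄(G)^p lies in the image of G'' -/

namespace GGSData

variable {p : ℕ} [Fact p.Prime] {E : ZMod p → ZMod p} {G : Type*} [Group G] (D : GGSData p E G)

theorem eq_top_of_mem {K : Subgroup G} {t r : ZMod p} (hr : r ≠ 0)
    (h1 : D.b * D.a ^ t.val ∈ K) (h2 : D.a ^ r.val ∈ K) : K = ⊤ := by
  have ha : ∀ s : ZMod p, D.a ^ s.val ∈ K := by
    intro s
    have := K.pow_mem h2 (r⁻¹ * s).val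
    rwa [← pow_val_mul D.a_pow, mul_inv_cancel_left₀ hr] at this
  have hb : D.b ∈ K := (K.mul_mem_cancel_right (ha t)).1 h1
  have ha1 := ha 1
  rw [pow_val_one] at ha1
  exact top_le_iff.1 fun g _ => D.mul_induction ha1 hb (fun _ _ => K.mul_mem) g

theorem sec_conjB_mul_inv {i j k : ZMod p} (hi : k ≠ i) (hj : k ≠ j) :
    D.sec (D.conjB i * (D.conjB j)⁻¹) k = D.a ^ (E (k - i) - E (k - j)).val := by
  rw [D.sec_mul_of_lvl _ (by rw [lvl_inv, lvl_conjB, neg_zero]), D.sec_inv_of_lvl (D.lvl_conjB j),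
    D.sec_conjB_of_ne hi, D.sec_conjB_of_ne hj, sub_eq_add_neg (E _), pow_val_add D.a_pow,
    pow_val_neg D.a_pow]

theorem sec_conjB_self_mul_inv {j k : ZMod p} (hj : k ≠ j) :
    D.sec (D.conjB k * (D.conjB j)⁻¹) k = D.b * D.a ^ (-E (k - j)).val := by
  rw [D.sec_mul_of_lvl _ (by rw [lvl_inv, lvl_conjB, neg_zero]), D.sec_inv_of_lvl (D.lvl_conjB j),
    sec_conjB_self, D.sec_conjB_of_ne hj, pow_val_neg D.a_pow]

theorem conjB_mul_inv_mem (i j : ZMod p) : D.conjB i * (D.conjB j)⁻¹ ∈ commutator G := by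
  rw [D.mem_commutator_iff, D.lvl_mul, lvl_inv, lvl_conjB, lvl_conjB, bexp_mul, bexp_inv,
    bexp_conjB, bexp_conjB]
  simp

/-- The sections of the first level stabilizer, as a homomorphism. -/
def secHom : D.stab →* (ZMod p → G) where
  toFun g := D.sec g
  map_one' := funext D.sec_one
  map_mul' _ h := funext fun k => D.sec_mul_of_lvl _ h.2 k

/-- The image of a subgroup under the section map of the first level stabilizer. -/
def secImage (T : Subgroup G) : Subgroup (ZMod p → G) := (T.subgroupOf D.stab).map D.secHom

theorem mem_secImage {T : Subgroup G} {f : ZMod p → G} :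
    f ∈ D.secImage T ↔ ∃ g ∈ T, D.lvl g = 0 ∧ D.sec g = f :=
  ⟨fun ⟨g, hg, h⟩ => ⟨g, hg, g.2, h⟩, fun ⟨g, hg, h0, h⟩ => ⟨⟨g, h0⟩, hg, h⟩⟩

/-- Every section of the derived subgroup at a given vertex of the first level is attained. -/
theorem exists_mem_commutator_sec_eq (k : ZMod p) (v : G) :
    ∃ g ∈ commutator G, D.sec g k = v := by
  obtain ⟨x, y, hx, hy, hxy⟩ := D.E_nonconst
  have h : ((D.secImage (commutator G)).map (Pi.evalMonoidHom _ k)) = ⊤ := by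
    -- At k, b_k b_(k-x)⁻¹ has section b a^(-E x), and b_(k-x) b_(k-y)⁻¹ has section a^(E x - E y),
    -- which is non-trivial because the tuple is not constant.
    refine D.eq_top_of_mem (t := -E x) (sub_ne_zero.2 hxy) ?_ ?_
    · refine ⟨_, D.mem_secImage.2 ⟨_, D.conjB_mul_inv_mem k (k - x), ?_, rfl⟩, ?_⟩
      · exact D.commutator_le_stab (D.conjB_mul_inv_mem _ _)
      · have : k ≠ k - x := fun h => hx (by linear_combination h)
        rw [Pi.evalMonoidHom_apply, D.sec_conjB_self_mul_inv this, sub_sub_cancel]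
    · refine ⟨_, D.mem_secImage.2 ⟨_, D.conjB_mul_inv_mem (k - x) (k - y), ?_, rfl⟩, ?_⟩
      · exact D.commutator_le_stab (D.conjB_mul_inv_mem _ _)
      · have h1 : k ≠ k - x := fun h => hx (by linear_combination h)
        have h2 : k ≠ k - y := fun h => hy (by linear_combination h)
        rw [Pi.evalMonoidHom_apply, D.sec_conjB_mul_inv h1 h2, sub_sub_cancel, sub_sub_cancel]
  obtain ⟨_, hf, rfl⟩ := (h ▸ Subgroup.mem_top v :
    v ∈ (D.secImage (commutator G)).map (Pi.evalMonoidHom _ k))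
  obtain ⟨g, hg, -, rfl⟩ := D.mem_secImage.1 hf
  exact ⟨g, hg, rfl⟩

/-- The elements which occur as the only non-trivial section of an element of `T`. -/
def rist (T : Subgroup G) : Subgroup G :=
  ⨅ k, (D.secImage T).comap (MonoidHom.mulSingle (fun _ => G) k)

theorem mem_rist {T : Subgroup G} {u : G} :
    u ∈ D.rist T ↔ ∀ k, ∃ g ∈ T, D.lvl g = 0 ∧ D.sec g = Pi.mulSingle k u := by
  simp only [rist, Subgroup.mem_iInf, Subgroup.mem_comap, mem_secImage]
  rfl

theorem rist_mono {T U : Subgroup G} (h : T ≤ U) : D.rist T ≤ D.rist U := fun u hu =>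
  D.mem_rist.2 fun k => by
    obtain ⟨g, hg, h'⟩ := D.mem_rist.1 hu k
    exact ⟨g, h hg, h'⟩

/-- For normal T one position suffices, since conjugation by powers of a permutes the positions
transitively. -/
theorem mem_rist_of_sec_eq {T : Subgroup G} [hT : T.Normal] {k : ZMod p} {u g : G} (hg : g ∈ T)
    (hl : D.lvl g = 0) (hs : D.sec g = Pi.mulSingle k u) : u ∈ D.rist T := by
  refine D.mem_rist.2 fun j => ⟨D.a ^ (j - k).val * g * (D.a ^ (j - k).val)⁻¹, hT.conj_mem _ hg _,
    by rw [lvl_conj, hl], funext fun i => ?_⟩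
  rw [D.sec_conj hl, sec_a_pow, lvl_a_pow_val, hs, one_mul, inv_one, mul_one,
    Pi.mulSingle_apply, Pi.mulSingle_apply]
  congr 1
  exact propext ⟨fun h => by linear_combination h, fun h => by linear_combination h⟩

/-- Conjugation by x in one coordinate is induced by an element of G' with section x there. -/
instance (T : Subgroup G) [hT : T.Normal] : (D.rist T).Normal := by
  refine ⟨fun u hu x => ?_⟩
  obtain ⟨g, hg, hl, hs⟩ := D.mem_rist.1 hu 0
  obtain ⟨h, hh, rfl⟩ := D.exists_mem_commutator_sec_eq 0 x
  have hh0 : D.lvl h = 0 := D.commutator_le_stab hh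
  refine D.mem_rist_of_sec_eq (k := 0) (hT.conj_mem g hg h) (by rw [lvl_conj, hl])
    (funext fun i => ?_)
  rw [D.sec_conj hl, hh0, sub_zero, hs, Pi.mulSingle_apply, Pi.mulSingle_apply]
  split_ifs with hi
  · rw [hi]
  · rw [mul_one, mul_inv_cancel]

theorem exists_sec_eq_of_mem_rist {T : Subgroup G} {f : ZMod p → G} (hf : ∀ k, f k ∈ D.rist T) :
    ∃ g ∈ T, D.lvl g = 0 ∧ D.sec g = f := by
  classical
  rw [← mem_secImage]
  have : Subgroup.pi Set.univ (fun _ : ZMod p => D.rist T) ≤ D.secImage T := by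
    rw [Subgroup.pi_le_iff]
    rintro k _ ⟨u, hu, rfl⟩
    exact D.mem_secImage.2 (D.mem_rist.1 hu k)
  exact this fun k _ => hf k

theorem commutator_le_of_mem {Z : Subgroup G} [Z.Normal] {s : ZMod p} (hs : s ≠ 0)
    (h : ⁅D.b, D.a ^ s.val⁆ ∈ Z) : commutator G ≤ Z := by
  set f := QuotientGroup.mk' Z with hf
  have hab : Commute (f D.b) (f D.a) := by
    have h1 : Commute (f D.b) (f D.a ^ s.val) := by
      rw [commute_iff_eq, ← commutatorElement_eq_one_iff_mul_comm, ← map_pow,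
        ← map_commutatorElement, ← MonoidHom.mem_ker, QuotientGroup.ker_mk']
      exact h
    have h2 := h1.pow_right (s⁻¹).val
    rwa [← pow_val_mul (by rw [← map_pow, D.a_pow, map_one]), mul_inv_cancel₀ hs,
      pow_val_one] at h2
  have h1 : ∀ g, Commute (f g) (f D.a) ∧ Commute (f g) (f D.b) := by
    refine D.mul_induction ⟨Commute.refl _, hab.symm⟩ ⟨hab, Commute.refl _⟩ ?_
    intro x y hx hy
    rw [map_mul]
    exact ⟨hx.1.mul_left hy.1, hx.2.mul_left hy.2⟩
  have h2 : ∀ h g, Commute (f g) (f h) := by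
    refine D.mul_induction (fun g => (h1 g).1) (fun g => (h1 g).2) ?_
    intro x y hx hy g
    rw [map_mul]
    exact (hx g).mul_right (hy g)
  rw [commutator_def, Subgroup.commutator_le]
  intro g _ h _
  rw [← QuotientGroup.ker_mk' Z, MonoidHom.mem_ker, map_commutatorElement,
    commutatorElement_eq_one_iff_mul_comm]
  exact h2 h g

/-- Because a^s generates ⟨a⟩, centrality of [b, a^s] modulo N makes all of G' central modulo N. -/
theorem gamma₃_le_of_forall {N : Subgroup G} [N.Normal] {s : ZMod p} (hs : s ≠ 0)
    (h : ∀ v, ⁅⁅D.b, D.a ^ s.val⁆, v⁆ ∈ N) : gamma₃ G ≤ N := by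
  have hZ : commutator G ≤ (Subgroup.center (G ⧸ N)).comap (QuotientGroup.mk' N) := by
    refine D.commutator_le_of_mem hs ?_
    rw [Subgroup.mem_comap, Subgroup.mem_center_iff]
    intro q
    obtain ⟨v, rfl⟩ := QuotientGroup.mk'_surjective N q
    symm
    rw [← commutatorElement_eq_one_iff_mul_comm, ← map_commutatorElement, ← MonoidHom.mem_ker,
      QuotientGroup.ker_mk']
    exact h v
  rw [gamma₃, Subgroup.commutator_le]
  intro x hx v _
  rw [← QuotientGroup.ker_mk' N, MonoidHom.mem_ker, map_commutatorElement,
    commutatorElement_eq_one_iff_mul_comm]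
  exact (Subgroup.mem_center_iff.1 (hZ hx) _).symm

/-- The elements commuting with `z` modulo a normal subgroup `N`. -/
def centralizerMod (N : Subgroup G) [N.Normal] (z : G) : Subgroup G :=
  (Subgroup.centralizer {QuotientGroup.mk' N z}).comap (QuotientGroup.mk' N)

theorem mem_centralizerMod {N : Subgroup G} [N.Normal] {z u : G} :
    u ∈ centralizerMod N z ↔ ⁅z, u⁆ ∈ N := by
  rw [centralizerMod, Subgroup.mem_comap, Subgroup.mem_centralizer_singleton_iff, eq_comm,
    ← commutatorElement_eq_one_iff_mul_comm, ← map_commutatorElement, ← MonoidHom.mem_ker,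
    QuotientGroup.ker_mk']

theorem mem_centralizerMod_comm {N : Subgroup G} [N.Normal] {z u : G} :
    u ∈ centralizerMod N z ↔ z ∈ centralizerMod N u := by
  rw [mem_centralizerMod, mem_centralizerMod, ← commutatorElement_inv, N.inv_mem_iff]

/-- γ₃ lies in the normal closure of the elements [[b, a^s], v], so commutation modulo N need only
be tested on these. Their conjugates are traded for conjugates of u. -/
theorem commutator_mem_of_forall {N : Subgroup G} [hN : N.Normal] {s : ZMod p} (hs : s ≠ 0) {u : G}
    (h : ∀ v x : G, ⁅⁅⁅D.b, D.a ^ s.val⁆, v⁆, x * u * x⁻¹⁆ ∈ N) {z : G} (hz : z ∈ gamma₃ G) :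
    ⁅z, u⁆ ∈ N := by
  have h1 : gamma₃ G ≤ Subgroup.normalClosure (Set.range fun v : G => ⁅⁅D.b, D.a ^ s.val⁆, v⁆) :=
    D.gamma₃_le_of_forall hs fun v => Subgroup.subset_normalClosure ⟨v, rfl⟩
  rw [← mem_centralizerMod, mem_centralizerMod_comm]
  refine (Subgroup.closure_le _).2 ?_ (h1 hz)
  intro y hy
  obtain ⟨_, ⟨v, rfl⟩, hc⟩ := Group.mem_conjugatesOfSet_iff.1 hy
  obtain ⟨x, rfl⟩ := isConj_iff.1 hc
  rw [SetLike.mem_coe, mem_centralizerMod_comm, mem_centralizerMod]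
  have := hN.conj_mem _ (h v x⁻¹) x
  change ⁅x * ⁅⁅D.b, D.a ^ s.val⁆, v⁆ * x⁻¹, u⁆ ∈ N
  generalize ⁅⁅D.b, D.a ^ s.val⁆, v⁆ = y at this ⊢
  rw [← MulAut.conj_apply, map_commutatorElement] at this
  simpa [mul_assoc] using this

/-- The commutator of two conjugates of `b`, which has at most two non-trivial sections. -/
theorem sec_commutator_conjB (m k : ZMod p) :
    D.sec ⁅D.conjB m, D.conjB 0⁆ k =
      if k = m then ⁅D.sec (D.conjB m) m, D.sec (D.conjB 0) m⁆
      else if k = 0 then ⁅D.sec (D.conjB m) 0, D.sec (D.conjB 0) 0⁆ else 1 := by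
  rw [D.sec_commutator (D.lvl_conjB m) (D.lvl_conjB 0)]
  split_ifs with h1 h2
  · rw [h1]
  · rw [h2]
  · rw [D.sec_conjB_of_ne h1, D.sec_conjB_of_ne h2, commutatorElement_eq_one_iff_mul_comm,
      ← pow_add, ← pow_add, add_comm]

theorem commutator_conjB_mem (m : ZMod p) : ⁅D.conjB m, D.conjB 0⁆ ∈ commutator G := by
  rw [commutator_def]
  exact Subgroup.commutator_mem_commutator (Subgroup.mem_top _) (Subgroup.mem_top _)

theorem sec_commutator_conjB_self {m : ZMod p} (hm : m ≠ 0) :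
    D.sec ⁅D.conjB m, D.conjB 0⁆ m = ⁅D.b, D.a ^ (E m).val⁆ := by
  rw [sec_commutator_conjB, if_pos rfl, sec_conjB_self, D.sec_conjB_of_ne hm, sub_zero]

theorem sec_commutator_conjB_zero {m : ZMod p} (hm : m ≠ 0) :
    D.sec ⁅D.conjB m, D.conjB 0⁆ 0 = ⁅D.a ^ (E (-m)).val, D.b⁆ := by
  rw [sec_commutator_conjB, if_neg hm.symm, if_pos rfl, sec_conjB_self,
    D.sec_conjB_of_ne hm.symm, zero_sub]

theorem sec_commutator_conjB_of_ne {m k : ZMod p} (hk : k ≠ m) (hk0 : k ≠ 0) :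
    D.sec ⁅D.conjB m, D.conjB 0⁆ k = 1 := by
  rw [sec_commutator_conjB, if_neg hk, if_neg hk0]

/-- For h in G' the element [[b_m, b_0], h] of G'' is supported on m and 0. A commutator with a
conjugate of g removes the section at 0 and stays in the normal subgroup G''. -/
theorem commutator_mem_rist {m : ZMod p} (hm : E m ≠ 0) {g : G} (hg : D.lvl g = 0)
    (h0 : D.sec g 0 = 1) {z : G} (hz : z ∈ gamma₃ G) :
    ⁅z, D.sec g m⁆ ∈ D.rist ⁅commutator G, commutator G⁆ := by
  have hm0 : m ≠ 0 := fun h => hm (by rw [h, D.E_zero])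
  refine D.commutator_mem_of_forall hm (fun v x => ?_) hz
  obtain ⟨h, hh, rfl⟩ := D.exists_mem_commutator_sec_eq m v
  obtain ⟨s, hs, rfl⟩ := D.exists_mem_commutator_sec_eq m x
  have hw := D.commutator_conjB_mem m
  have hw0 : D.lvl ⁅D.conjB m, D.conjB 0⁆ = 0 := D.lvl_commutator _ _
  have hh0 : D.lvl h = 0 := D.commutator_le_stab hh
  have hs0 : D.lvl s = 0 := D.commutator_le_stab hs
  have hl := D.lvl_commutator ⁅D.conjB m, D.conjB 0⁆ h
  have hc : D.lvl (s * g * s⁻¹) = 0 := by rw [lvl_conj, hg]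
  have h1 : ⁅⁅D.conjB m, D.conjB 0⁆, h⁆ ∈ ⁅commutator G, commutator G⁆ :=
    Subgroup.commutator_mem_commutator hw hh
  refine D.mem_rist_of_sec_eq (g := ⁅⁅⁅D.conjB m, D.conjB 0⁆, h⁆, s * g * s⁻¹⁆) (k := m)
    (Subgroup.commutator_le_left _ ⊤ (Subgroup.commutator_mem_commutator h1 (Subgroup.mem_top _)))
    (D.lvl_commutator _ _) (funext fun k => ?_)
  rw [D.sec_commutator hl hc, D.sec_commutator hw0 hh0, D.sec_conj hg, hs0, sub_zero,
    Pi.mulSingle_apply]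
  split_ifs with hk
  · rw [hk, D.sec_commutator_conjB_self hm0]
  · by_cases hk0 : k = 0
    · rw [hk0, h0, mul_one, mul_inv_cancel, commutatorElement_one_right]
    · rw [D.sec_commutator_conjB_of_ne hk hk0, commutatorElement_one_left,
        commutatorElement_one_left]

/-- Here the section of [b_m, b_0] at 0 is [a^0, b] = 1, so no second commutator is needed. -/
theorem gamma₃_le_rist_of_eq_zero {m : ZMod p} (hm : E m ≠ 0) (hm' : E (-m) = 0) :
    gamma₃ G ≤ D.rist ⁅commutator G, commutator G⁆ := by
  have hm0 : m ≠ 0 := fun h => hm (by rw [h, D.E_zero])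
  refine D.gamma₃_le_of_forall hm fun v => ?_
  obtain ⟨h, hh, rfl⟩ := D.exists_mem_commutator_sec_eq m v
  refine D.mem_rist_of_sec_eq (g := ⁅⁅D.conjB m, D.conjB 0⁆, h⁆) (k := m)
    (Subgroup.commutator_mem_commutator (D.commutator_conjB_mem m) hh)
    (D.lvl_commutator _ _) (funext fun k => ?_)
  rw [D.sec_commutator (D.lvl_commutator _ _) (D.commutator_le_stab hh), Pi.mulSingle_apply]
  split_ifs with hk
  · rw [hk, D.sec_commutator_conjB_self hm0]
  · by_cases hk0 : k = 0
    · rw [hk0, D.sec_commutator_conjB_zero hm0, hm', ZMod.val_zero, pow_zero,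
        commutatorElement_one_left, commutatorElement_one_left]
    · rw [D.sec_commutator_conjB_of_ne hk hk0, commutatorElement_one_left]

/-- The exponent of b_(-m) is chosen to cancel the section a^(E (-m)) of b_m at 0; the section at m
is then the given element. -/
theorem mul_a_pow_mem_centralizerMod {m : ZMod p} (hm : E m ≠ 0) {z : G} (hz : z ∈ gamma₃ G) :
    D.b * D.a ^ (E (m + m) * (-E (-m) / E m)).val ∈
      centralizerMod (D.rist ⁅commutator G, commutator G⁆) z := by
  have hm0 : m ≠ 0 := fun h => hm (by rw [h, D.E_zero])
  have hmm := ZMod.ne_neg_self_of_ne D.odd hm0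
  have hp : D.lvl (D.conjB (-m) ^ (-E (-m) / E m).val) = 0 := by rw [lvl_pow, lvl_conjB, mul_zero]
  have hl : D.lvl (D.conjB m * D.conjB (-m) ^ (-E (-m) / E m).val) = 0 := by
    rw [D.lvl_mul, hp, lvl_conjB, add_zero]
  rw [mem_centralizerMod]
  have := D.commutator_mem_rist hm hl ?_ hz
  · rwa [D.sec_mul_of_lvl _ hp, D.sec_pow (D.lvl_conjB _), sec_conjB_self, D.sec_conjB_of_ne hmm,
      sub_neg_eq_add, ← pow_val_mul D.a_pow] at this
  · rw [D.sec_mul_of_lvl _ hp, D.sec_pow (D.lvl_conjB _), D.sec_conjB_of_ne hm0.symm,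
      D.sec_conjB_of_ne (neg_ne_zero.2 hm0).symm, ← pow_val_mul D.a_pow, ← pow_val_add D.a_pow,
      zero_sub, zero_sub, neg_neg, mul_div_cancel₀ _ hm, add_neg_cancel, ZMod.val_zero, pow_zero]

/-- The product b_i^(E (-j)) b_j^(-E (-i)) has trivial section at 0 and the given section at m. -/
theorem a_pow_mem_centralizerMod {m : ZMod p} (hm : E m ≠ 0) {z : G} (hz : z ∈ gamma₃ G)
    {i j : ZMod p} (hi : i ≠ 0) (him : i ≠ m) (hj : j ≠ 0) (hjm : j ≠ m) :
    D.a ^ (E (m - i) * E (-j) - E (m - j) * E (-i)).val ∈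
      centralizerMod (D.rist ⁅commutator G, commutator G⁆) z := by
  have hp : ∀ (i : ZMod p) (n : ℕ), D.lvl (D.conjB i ^ n) = 0 := fun i n => by
    rw [lvl_pow, lvl_conjB, mul_zero]
  have hl : D.lvl (D.conjB i ^ (E (-j)).val * D.conjB j ^ (-E (-i)).val) = 0 := by
    rw [D.lvl_mul, hp, hp, add_zero]
  have hs : ∀ k, k ≠ i → k ≠ j → D.sec (D.conjB i ^ (E (-j)).val * D.conjB j ^ (-E (-i)).val) k =
      D.a ^ (E (k - i) * E (-j) - E (k - j) * E (-i)).val := by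
    intro k hki hkj
    rw [D.sec_mul_of_lvl _ (hp _ _), D.sec_pow (D.lvl_conjB _), D.sec_pow (D.lvl_conjB _),
      D.sec_conjB_of_ne hki, D.sec_conjB_of_ne hkj, ← pow_val_mul D.a_pow, ← pow_val_mul D.a_pow,
      ← pow_val_add D.a_pow]
    congr 2; ring
  rw [mem_centralizerMod, ← hs m him.symm hjm.symm]
  refine D.commutator_mem_rist hm hl ?_ hz
  rw [hs 0 hi.symm hj.symm, zero_sub, zero_sub, mul_comm, sub_self, ZMod.val_zero, pow_zero]

include D in
theorem exists_E_ne_zero : ∃ m, E m ≠ 0 := by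
  by_contra! h
  exact D.E_ne_zero (funext h)

/-- If E (-m) ≠ 0, the centralizer of z in γ₃ modulo the rigid stabilizer contains some b a^t for
each of m and -m, and powers of a. By `exists_mul_ne_or_ne` either one of these powers is
non-trivial or the two values of t differ; both cases give the whole group. -/
theorem gamma₄_le_rist : gamma₄ G ≤ D.rist ⁅commutator G, commutator G⁆ := by
  obtain ⟨m, hm⟩ := D.exists_E_ne_zero
  by_cases hm' : E (-m) = 0
  · exact (Subgroup.commutator_le_left _ _).trans (D.gamma₃_le_rist_of_eq_zero hm hm')
  rw [gamma₄, Subgroup.commutator_le]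
  intro z hz v _
  rw [← mem_centralizerMod]
  suffices h : centralizerMod (D.rist ⁅commutator G, commutator G⁆) z = ⊤ from
    h ▸ Subgroup.mem_top v
  have h1 := D.mul_a_pow_mem_centralizerMod hm hz
  rcases exists_mul_ne_or_ne D.odd D.E_zero D.E_nonconst hm hm' with
    ⟨i, j, hi, him, hj, hjm, h⟩ | h
  · exact D.eq_top_of_mem (sub_ne_zero.2 h) h1 (D.a_pow_mem_centralizerMod hm hz hi him hj hjm)
  · have h2 := D.mul_a_pow_mem_centralizerMod hm' hz
    rw [neg_neg] at h2
    refine D.eq_top_of_mem (sub_ne_zero.2 h) h1 ?_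
    have h3 := Subgroup.mul_mem _ (Subgroup.inv_mem _ h2) h1
    rwa [mul_inv_rev, mul_assoc, inv_mul_cancel_left, ← pow_val_neg D.a_pow,
      ← pow_val_add D.a_pow, neg_add_eq_sub] at h3

end GGSData

/-! ### Linear algebra modulo γ₄(G): γ₃(G)^p lies in the image of G'' -/

namespace GGSData

variable {p : ℕ} [Fact p.Prime] {E : ZMod p → ZMod p} {G : Type*} [Group G] (D : GGSData p E G)

theorem theta_c_pow (n : ℕ) : D.theta (D.c ^ n) = n := by
  induction n with
  | zero => simp [theta_one]
  | succ n ih => rw [pow_succ, D.theta_mul_of_mem D.c_mem, ih, theta_c]; push_cast; rfl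

theorem inv_mul_mem_gamma₃ {x y : G} (hx : x ∈ commutator G) (hy : y ∈ commutator G)
    (h : D.theta x = D.theta y) : x⁻¹ * y ∈ gamma₃ G := by
  have h2 := mul_mem (inv_mem hx) hy
  have h3 := D.theta_mul_of_mem (g := x) h2
  rw [mul_inv_cancel_left, h, left_eq_add] at h3
  rw [D.mem_gamma₃_iff]
  exact ⟨(D.mem_commutator_iff.1 h2).1, (D.mem_commutator_iff.1 h2).2, h3⟩

theorem c_pow_inv_mul_mem {y : G} (hy : y ∈ commutator G) :
    (D.c ^ (D.theta y).val)⁻¹ * y ∈ gamma₃ G :=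
  D.inv_mul_mem_gamma₃ (pow_mem D.c_mem _) hy (by rw [theta_c_pow, ZMod.natCast_zmod_val])

section GammaFour

variable {Q : Type*} [Group Q] {f : G →* Q} (hf : ∀ z ∈ gamma₃ G, ∀ q, Commute (f z) q)
include hf

theorem map_commutator_mul_right {y : G} (hy : y ∈ commutator G) (g h : G) :
    f ⁅y, g * h⁆ = f ⁅y, g⁆ * f ⁅y, h⁆ := by
  have h1 : ⁅y, g * h⁆ = ⁅y, g⁆ * (g * ⁅y, h⁆ * g⁻¹) := by
    simp only [commutatorElement_def]; group
  have h2 := (hf _ (Subgroup.commutator_mem_commutator hy (Subgroup.mem_top h)) (f g)).eq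
  rw [h1, map_mul, map_mul, map_mul, ← h2, map_inv, mul_inv_cancel_right]

theorem map_commutator_mul_left (x : G) {y : G} (hy : y ∈ commutator G) (g : G) :
    f ⁅x * y, g⁆ = f ⁅x, g⁆ * f ⁅y, g⁆ := by
  have h1 : ⁅x * y, g⁆ = x * ⁅y, g⁆ * x⁻¹ * ⁅x, g⁆ := by
    simp only [commutatorElement_def]; group
  have h2 := hf _ (Subgroup.commutator_mem_commutator hy (Subgroup.mem_top g))
  rw [h1, map_mul, map_mul, map_mul, ← (h2 (f x)).eq, map_inv, mul_inv_cancel_right, (h2 _).eq]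

theorem map_commutator_pow_right {y : G} (hy : y ∈ commutator G) (g : G) (n : ℕ) :
    f ⁅y, g ^ n⁆ = f ⁅y, g⁆ ^ n := by
  induction n with
  | zero => simp
  | succ n ih => rw [pow_succ, map_commutator_mul_right hf hy, ih, pow_succ]

theorem map_commutator_pow_left {y : G} (hy : y ∈ commutator G) (g : G) (n : ℕ) :
    f ⁅y ^ n, g⁆ = f ⁅y, g⁆ ^ n := by
  induction n with
  | zero => simp
  | succ n ih => rw [pow_succ, map_commutator_mul_left hf _ hy, ih, pow_succ]

theorem map_commutator_a_pow : f ⁅D.c, D.a⁆ ^ p = 1 := by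
  rw [← map_commutator_pow_right hf D.c_mem, D.a_pow, commutatorElement_one_right, map_one]

theorem map_commutator_b_pow : f ⁅D.c, D.b⁆ ^ p = 1 := by
  rw [← map_commutator_pow_right hf D.c_mem, D.b_pow, commutatorElement_one_right, map_one]

/-- The value in a quotient of nilpotency class three of the monomial with the given exponents in
`⁅c, a⁆` and `⁅c, b⁆`. -/
def monomial (f : G →* Q) (w : ZMod p × ZMod p) : Q :=
  f ⁅D.c, D.a⁆ ^ w.1.val * f ⁅D.c, D.b⁆ ^ w.2.val

omit hf in
theorem monomial_zero : D.monomial f 0 = 1 := by simp [monomial]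

theorem monomial_add (v w : ZMod p × ZMod p) :
    D.monomial f (v + w) = D.monomial f v * D.monomial f w := by
  have hc := hf _ (Subgroup.commutator_mem_commutator D.c_mem (Subgroup.mem_top D.a))
  rw [monomial, monomial, monomial, Prod.fst_add, Prod.snd_add,
    pow_val_add (D.map_commutator_a_pow hf), pow_val_add (D.map_commutator_b_pow hf),
    mul_assoc, mul_assoc]
  congr 1
  rw [← mul_assoc, ← mul_assoc, ((hc _).pow_left _).eq]

theorem monomial_neg (w : ZMod p × ZMod p) : D.monomial f (-w) = (D.monomial f w)⁻¹ := by
  rw [eq_inv_iff_mul_eq_one, ← D.monomial_add hf, neg_add_cancel, monomial_zero]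

/-- When γ₃ is central, the commutator of G' with G is bimultiplicative. It depends on y only
through its power of c modulo γ₃. -/
theorem map_commutator_eq {y : G} (hy : y ∈ commutator G) (g : G) :
    f ⁅y, g⁆ = D.monomial f (D.theta y * D.lvl g, D.theta y * D.bexp g) := by
  have h1 : ∀ g, f ⁅D.c, g⁆ = D.monomial f (D.lvl g, D.bexp g) := by
    refine D.mul_induction ?_ ?_ ?_
    · rw [lvl_a, bexp_a, monomial, pow_val_one, ZMod.val_zero, pow_zero, mul_one]
    · rw [lvl_b, bexp_b, monomial, pow_val_one, ZMod.val_zero, pow_zero, one_mul]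
    · intro x y hx hy
      rw [map_commutator_mul_right hf D.c_mem, hx, hy, D.lvl_mul, bexp_mul,
        ← D.monomial_add hf]
      rfl
  have hz := D.c_pow_inv_mul_mem hy
  have h4 : f ⁅y, g⁆ = f ⁅D.c, g⁆ ^ (D.theta y).val := by
    have h5 : y = D.c ^ (D.theta y).val * ((D.c ^ (D.theta y).val)⁻¹ * y) := by group
    have h6 : f ⁅(D.c ^ (D.theta y).val)⁻¹ * y, g⁆ = 1 := by
      rw [map_commutatorElement, commutatorElement_eq_one_iff_mul_comm]
      exact hf _ hz _
    conv_lhs => rw [h5]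
    rw [map_commutator_mul_left hf _ (gamma₃_le_commutator G hz), h6, mul_one,
      map_commutator_pow_left hf D.c_mem]
  have hc := hf _ (Subgroup.commutator_mem_commutator D.c_mem (Subgroup.mem_top D.a))
  rw [h4, h1, monomial, monomial, ((hc _).pow_left _).mul_pow, mul_comm (D.theta y),
    mul_comm (D.theta y), pow_val_mul (D.map_commutator_a_pow hf),
    pow_val_mul (D.map_commutator_b_pow hf)]

end GammaFour

/-- The exponents modulo the fourth term of the lower central series which are attained by the
tuples of sections of elements of the second derived subgroup. -/
def exponentSpace {Q : Type*} [Group Q] (f : G →* Q)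
    (hf : ∀ z ∈ gamma₃ G, ∀ q, Commute (f z) q) :
    Submodule (ZMod p) (ZMod p → ZMod p × ZMod p) :=
  AddSubgroup.toZModSubmodule p
    { carrier := {w | ∃ g ∈ ⁅commutator G, commutator G⁆, D.lvl g = 0 ∧
        ∀ k, f (D.sec g k) = D.monomial f (w k)}
      zero_mem' := ⟨1, one_mem _, D.lvl_one, fun k => by
        rw [sec_one, map_one, Pi.zero_apply, monomial_zero]⟩
      add_mem' := by
        rintro v w ⟨g, hg, hg0, hv⟩ ⟨h, hh, hh0, hw⟩
        exact ⟨g * h, mul_mem hg hh, by rw [D.lvl_mul, hg0, hh0, add_zero], fun k => by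
          rw [D.sec_mul_of_lvl _ hh0, map_mul, hv, hw, Pi.add_apply, D.monomial_add hf]⟩
      neg_mem' := by
        rintro w ⟨g, hg, hg0, hw⟩
        exact ⟨g⁻¹, inv_mem hg, by rw [lvl_inv, hg0, neg_zero], fun k => by
          rw [D.sec_inv_of_lvl hg0, map_inv, hw, Pi.neg_apply, D.monomial_neg hf]⟩ }

theorem mem_exponentSpace {Q : Type*} [Group Q] {f : G →* Q}
    {hf : ∀ z ∈ gamma₃ G, ∀ q, Commute (f z) q} {w : ZMod p → ZMod p × ZMod p} :
    w ∈ D.exponentSpace f hf ↔ ∃ g ∈ ⁅commutator G, commutator G⁆, D.lvl g = 0 ∧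
        ∀ k, f (D.sec g k) = D.monomial f (w k) := Iff.rfl

theorem sec_conj_a (g : G) (hg : D.lvl g = 0) (k : ZMod p) :
    D.sec (D.a⁻¹ * g * D.a⁻¹⁻¹) k = D.sec g (k + 1) := by
  rw [D.sec_conj hg, sec_inv, sec_a, lvl_inv, lvl_a, inv_one, one_mul, inv_one, mul_one,
    sub_neg_eq_add]

/-- By Nakayama it suffices that the sums over the positions fill F_p². Otherwise a non-zero
functional vanishes on them, which the elements [[b_m, b_0], b_i b_j⁻¹] of G'' exclude. -/
theorem exponentSpace_eq_top {Q : Type*} [Group Q] {f : G →* Q}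
    (hf : ∀ z ∈ gamma₃ G, ∀ q, Commute (f z) q) : D.exponentSpace f hf = ⊤ := by
  have hshift : ∀ w ∈ D.exponentSpace f hf, (fun k => w (k + 1)) ∈ D.exponentSpace f hf := by
    rintro w ⟨g, hg, hg0, hw⟩
    refine ⟨D.a⁻¹ * g * D.a⁻¹⁻¹, (inferInstance : (⁅commutator G, commutator G⁆).Normal).conj_mem
      _ hg _, by rw [lvl_conj, hg0], fun k => ?_⟩
    rw [D.sec_conj_a g hg0, hw]
  refine eq_top_of_forall_exists_sum_eq hshift ?_
  let S : (ZMod p → ZMod p × ZMod p) →ₗ[ZMod p] ZMod p × ZMod p := ∑ k, LinearMap.proj k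
  have hS : ∀ w, S w = ∑ k, w k := fun w => by simp [S]
  suffices h : (D.exponentSpace f hf).map S = ⊤ by
    intro v
    obtain ⟨w, hw, rfl⟩ : v ∈ (D.exponentSpace f hf).map S := h ▸ Submodule.mem_top
    exact ⟨w, hw, (hS w).symm⟩
  by_contra hne
  obtain ⟨φ, hφ, hle⟩ := Submodule.exists_le_ker_of_lt_top _ (lt_top_iff_ne_top.2 hne)
  obtain ⟨m, hm⟩ := D.exists_E_ne_zero
  have hm0 : m ≠ 0 := fun h => hm (by rw [h, D.E_zero])
  have hφ' : ∀ x y, φ (x, y) = φ (1, 0) * x + φ (0, 1) * y := by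
    intro x y
    have : ((x, y) : ZMod p × ZMod p) = x • (1, 0) + y • (0, 1) := by simp
    rw [this, map_add, map_smul, map_smul, smul_eq_mul, smul_eq_mul, mul_comm x, mul_comm y]
  -- The factors -E m and E (-m) are the c-exponents of the two non-trivial sections of [b_m, b_0].
  have key : ∀ g ∈ commutator G,
      -E m * (φ (1, 0) * D.lvl (D.sec g m) + φ (0, 1) * D.bexp (D.sec g m)) +
      E (-m) * (φ (1, 0) * D.lvl (D.sec g 0) + φ (0, 1) * D.bexp (D.sec g 0)) = 0 := by
    intro g hg
    set w : ZMod p → ZMod p × ZMod p :=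
      Pi.single (M := fun _ => ZMod p × ZMod p) m (-E m * D.lvl (D.sec g m), -E m * D.bexp (D.sec g m)) +
      Pi.single (M := fun _ => ZMod p × ZMod p) 0 (E (-m) * D.lvl (D.sec g 0), E (-m) * D.bexp (D.sec g 0)) with hw
    have hmem : w ∈ D.exponentSpace f hf := by
      refine ⟨⁅⁅D.conjB m, D.conjB 0⁆, g⁆,
        Subgroup.commutator_mem_commutator (D.commutator_conjB_mem m) hg,
        D.lvl_commutator _ _, fun k => ?_⟩
      have hc : ∀ x y : G, ⁅x, y⁆ ∈ commutator G := fun x y => by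
        rw [commutator_def]
        exact Subgroup.commutator_mem_commutator (Subgroup.mem_top _) (Subgroup.mem_top _)
      rw [D.sec_commutator (D.lvl_commutator _ _) (D.commutator_le_stab hg)]
      by_cases hkm : k = m
      · subst hkm
        rw [D.sec_commutator_conjB_self hm0, D.map_commutator_eq hf (hc _ _), theta_commutator,
          lvl_b, lvl_a_pow_val, bexp_b, hw]
        simp [hm0]
      · by_cases hk0 : k = 0
        · subst hk0
          rw [D.sec_commutator_conjB_zero hm0, D.map_commutator_eq hf (hc _ _), theta_commutator,
            lvl_b, lvl_a_pow_val, bexp_b, hw]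
          simp [hkm]
        · rw [D.sec_commutator_conjB_of_ne hkm hk0, commutatorElement_one_left, map_one, hw]
          simp [hkm, hk0, monomial_zero]
    have h1 : φ (S w) = 0 := hle ⟨w, hmem, rfl⟩
    rw [hS, hw] at h1
    simp only [Pi.add_apply, Finset.sum_add_distrib, Finset.sum_pi_single', Finset.mem_univ,
      if_true, map_add] at h1
    rw [hφ' (-E m * _), hφ' (E (-m) * _)] at h1
    linear_combination h1
  have h0 := functional_eq_zero D.odd D.E_zero D.E_nonconst hm (l := φ (1, 0)) (u := φ (0, 1)) ?_
  · refine hφ (LinearMap.ext fun x => ?_)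
    rw [← Prod.mk.eta (p := x), hφ' x.1 x.2, h0.1, h0.2, zero_mul, zero_mul, add_zero,
      LinearMap.zero_apply]
  · intro i j
    have h1 := key _ (D.conjB_mul_inv_mem i j)
    have hj : D.lvl (D.conjB j)⁻¹ = 0 := by rw [lvl_inv, lvl_conjB, neg_zero]
    rw [D.sec_mul_of_lvl _ hj, D.sec_mul_of_lvl _ hj, D.sec_inv_of_lvl (D.lvl_conjB j),
      D.sec_inv_of_lvl (D.lvl_conjB j)] at h1
    simp only [D.lvl_mul, bexp_mul, lvl_inv, bexp_inv, lvl_sec_conjB, bexp_sec_conjB,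
      zero_sub] at h1
    linear_combination h1

/-- An element of G'' has the desired sections modulo γ₄, and the error is corrected inside G'' by
`gamma₄_le_rist`. -/
theorem gamma₃_le_rist : gamma₃ G ≤ D.rist ⁅commutator G, commutator G⁆ := by
  have hf : ∀ z ∈ gamma₃ G, ∀ q, Commute (QuotientGroup.mk' (gamma₄ G) z) q :=
    fun z hz q => commute_mk_of_mem le_rfl hz q
  refine D.gamma₃_le_of_forall one_ne_zero fun v => ?_
  set y := ⁅D.b, D.a ^ (1 : ZMod p).val⁆ with hy
  have hyc : y ∈ commutator G := by
    rw [commutator_def]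
    exact Subgroup.commutator_mem_commutator (Subgroup.mem_top _) (Subgroup.mem_top _)
  obtain ⟨g, hg, hg0, hgs⟩ := D.mem_exponentSpace.1
    (D.exponentSpace_eq_top hf ▸ Submodule.mem_top :
      Pi.single (M := fun _ => ZMod p × ZMod p) 0 (D.theta y * D.lvl v, D.theta y * D.bexp v) ∈ D.exponentSpace _ hf)
  have hmod : ∀ k, (D.sec g k)⁻¹ * Pi.mulSingle (M := fun _ => G) 0 ⁅y, v⁆ k ∈ gamma₄ G := by
    intro k
    rw [← QuotientGroup.ker_mk' (gamma₄ G), MonoidHom.mem_ker, map_mul, map_inv, hgs]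
    rw [inv_mul_eq_one, Pi.single_apply, Pi.mulSingle_apply]
    split_ifs
    · exact (D.map_commutator_eq hf hyc v).symm
    · rw [monomial_zero, map_one]
  obtain ⟨h, hh, hh0, hhs⟩ := D.exists_sec_eq_of_mem_rist
    (f := fun k => (D.sec g k)⁻¹ * Pi.mulSingle (M := fun _ => G) 0 ⁅y, v⁆ k)
    fun k => D.gamma₄_le_rist (hmod k)
  refine D.mem_rist_of_sec_eq (k := 0) (mul_mem hg hh) (by rw [D.lvl_mul, hg0, hh0, add_zero])
    (funext fun k => ?_)
  rw [D.sec_mul_of_lvl _ hh0, hhs, mul_inv_cancel_left]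

end GGSData

/-! ### The bilinear forms giving the moments of commutators -/

section CommutatorForm

variable {p : ℕ} [Fact p.Prime]

theorem ZMod.eq_mul_of_additive {g : ZMod p → ZMod p} (hg : ∀ x y, g (x + y) = g x + g y)
    (x : ZMod p) : g x = g 1 * x := by
  have := (AddMonoidHom.toZModLinearMap p (AddMonoidHom.mk' g hg)).map_smul x 1
  rw [smul_eq_mul, smul_eq_mul, mul_one, mul_comm x] at this
  exact this

/-- The coefficients of the bilinear form which describes the moments of a commutator. -/
def commutatorForm (E : ZMod p → ZMod p) (n : ℕ) (i j : ZMod p) : ZMod p :=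
  j ^ n * E (j - i) - i ^ n * E (i - j)

variable {E : ZMod p → ZMod p}

theorem commutatorForm_zero_eq_zero_iff :
    (∀ i j, commutatorForm E 0 i j = 0) ↔ ∀ x, E (-x) = E x := by
  simp only [commutatorForm, pow_zero, one_mul, sub_eq_zero]
  exact ⟨fun h x => by simpa using h x 0, fun h i j => by rw [← neg_sub, h]⟩

/-- The form is x ↦ E x - E (-x) evaluated at j - i; the condition says that this odd function is
additive, hence linear. -/
theorem commutatorForm_zero_eq_add_iff :
    (∀ i j, commutatorForm E 0 i j = commutatorForm E 0 i 0 + commutatorForm E 0 0 j) ↔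
      ∃ l, ∀ x, E x - E (-x) = l * x := by
  simp only [commutatorForm, pow_zero, one_mul, zero_sub, sub_zero]
  constructor
  · intro h
    refine ⟨E 1 - E (-1), ZMod.eq_mul_of_additive (g := fun x => E x - E (-x)) fun x y => ?_⟩
    have := h x (-y)
    simp only [sub_neg_eq_add, neg_neg] at this
    rw [show -y - x = -(x + y) by ring] at this
    linear_combination -this
  · rintro ⟨l, hl⟩ i j
    have h1 := hl (i - j)
    have h2 := hl i
    have h3 := hl j
    rw [neg_sub] at h1
    linear_combination -h1 + h2 - h3

theorem exists_of_affine (hE0 : E 0 = 0) (h : ∃ s t, ∀ x, x ≠ 0 → E x = s * x + t) :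
    ∃ l, ∀ x, E x - E (-x) = l * x := by
  obtain ⟨s, t, h⟩ := h
  refine ⟨2 * s, fun x => ?_⟩
  by_cases hx : x = 0
  · simp [hx, hE0]
  · rw [h x hx, h (-x) (neg_ne_zero.2 hx)]; ring

/-- When the odd part is linear with slope l, the condition becomes additivity of x E x - (l / 2)
x²; dividing by x shows that E is affine off 0. -/
theorem commutatorForm_one_eq_add_iff (hp : p ≠ 2)
    (hE : ∃ l, ∀ x, E x - E (-x) = l * x) :
    (∀ i j, commutatorForm E 1 i j = commutatorForm E 1 i 0 + commutatorForm E 1 0 j) ↔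
      ∃ s t, ∀ x, x ≠ 0 → E x = s * x + t := by
  simp only [commutatorForm, pow_one, zero_sub, sub_zero, zero_mul]
  have h2 := ZMod.two_ne_zero_of_ne hp
  constructor
  · intro h
    obtain ⟨l, hl⟩ := hE
    have hadd : ∀ x y, (x + y) * E (x + y) - l / 2 * (x + y) ^ 2 =
        (x * E x - l / 2 * x ^ 2) + (y * E y - l / 2 * y ^ 2) := by
      intro x y
      have h1 := h (x + y) y
      rw [show y - (x + y) = -x by ring, add_sub_cancel_right] at h1
      have h3 := hl x
      have h4 : l / 2 * 2 = l := div_mul_cancel₀ _ h2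
      linear_combination h1 + y * h3 - x * y * h4
    refine ⟨l / 2, 1 * E 1 - l / 2 * 1 ^ 2, fun x hx => ?_⟩
    have h1 := ZMod.eq_mul_of_additive (g := fun x => x * E x - l / 2 * x ^ 2) hadd x
    refine mul_left_cancel₀ hx ?_
    linear_combination h1
  · rintro ⟨s, t, h⟩ i j
    have h3 : ∀ x, x * E x = s * x ^ 2 + t * x := by
      intro x
      by_cases hx : x = 0
      · simp [hx]
      · rw [h x hx]; ring
    by_cases hij : i = j
    · subst hij; ring
    · have hij' : i - j ≠ 0 := sub_ne_zero.2 hij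
      have hji' : j - i ≠ 0 := sub_ne_zero.2 (Ne.symm hij)
      rw [h _ hij', h _ hji']
      linear_combination h3 i - h3 j

/-- The pair (1, -1) forces the slope s to vanish, and then the tuple would be constant. -/
theorem not_commutatorForm_two_eq_add (hp : p ≠ 2)
    (hE : ∃ x y, x ≠ 0 ∧ y ≠ 0 ∧ E x ≠ E y) (h : ∃ s t, ∀ x, x ≠ 0 → E x = s * x + t) :
    ¬ ∀ i j, commutatorForm E 2 i j = commutatorForm E 2 i 0 + commutatorForm E 2 0 j := by
  intro hform
  obtain ⟨s, t, h⟩ := h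
  have h2 := ZMod.two_ne_zero_of_ne hp
  have h1 := hform 1 (-1)
  have hn : (-1 : ZMod p) ≠ 0 := neg_ne_zero.2 one_ne_zero
  have e1 : (-1 - 1 : ZMod p) ≠ 0 := fun h => h2 (by linear_combination -h)
  have e2 : (1 - -1 : ZMod p) ≠ 0 := fun h => h2 (by linear_combination h)
  simp only [commutatorForm, zero_sub, sub_zero] at h1
  rw [h _ e1, h _ e2, h _ hn, h 1 one_ne_zero] at h1
  have hs : s * 2 = 0 := by linear_combination -h1
  have hs0 := (mul_eq_zero.1 hs).resolve_right h2
  obtain ⟨x, y, hx, hy, hxy⟩ := hE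
  exact hxy (by rw [h x hx, h y hy, hs0, zero_mul, zero_mul])

end CommutatorForm

/-! ### The images of K' and G'' in (G'/γ₃(G))^p -/

namespace GGSData

variable {p : ℕ} [Fact p.Prime] {E : ZMod p → ZMod p} {G : Type*} [Group G] (D : GGSData p E G)

/-- The exponents of `⁅a, b⁆` of the sections. -/
noncomputable def thetaSec (g : G) (k : ZMod p) : ZMod p := D.theta (D.sec g k)

theorem thetaSec_mul (g : G) {h : G} (hh : h ∈ ⁅D.stab, D.stab⁆) :
    D.thetaSec (g * h) = D.thetaSec g + D.thetaSec h := funext fun k => by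
  rw [thetaSec, D.sec_mul_of_lvl _ (D.mem_commutator_stab_iff.1 hh).1,
    D.theta_mul_of_mem (D.sec_mem_commutator hh k)]
  rfl

theorem thetaSec_one : D.thetaSec 1 = 0 := funext fun k => by
  rw [thetaSec, sec_one, theta_one]; rfl

theorem thetaSec_inv {g : G} (hg : g ∈ ⁅D.stab, D.stab⁆) : D.thetaSec g⁻¹ = -D.thetaSec g := by
  rw [eq_neg_iff_add_eq_zero, ← D.thetaSec_mul _ hg, inv_mul_cancel, thetaSec_one]

/-- The image of `thetaSec` on a subgroup of the derived subgroup of the first level stabilizer. -/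
noncomputable def thetaImage (T : Subgroup G) (hT : T ≤ ⁅D.stab, D.stab⁆) :
    Submodule (ZMod p) (ZMod p → ZMod p) :=
  AddSubgroup.toZModSubmodule p
    { carrier := {w | ∃ g ∈ T, D.thetaSec g = w}
      zero_mem' := ⟨1, one_mem _, D.thetaSec_one⟩
      add_mem' := by
        rintro _ _ ⟨g, hg, rfl⟩ ⟨h, hh, rfl⟩
        exact ⟨g * h, mul_mem hg hh, D.thetaSec_mul _ (hT hh)⟩
      neg_mem' := by
        rintro _ ⟨g, hg, rfl⟩
        exact ⟨g⁻¹, inv_mem hg, D.thetaSec_inv (hT hg)⟩ }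

theorem mem_thetaImage {T : Subgroup G} {hT : T ≤ ⁅D.stab, D.stab⁆} {w : ZMod p → ZMod p} :
    w ∈ D.thetaImage T hT ↔ ∃ g ∈ T, D.thetaSec g = w := Iff.rfl

theorem thetaImage_shift {T : Subgroup G} [hN : T.Normal] {hT : T ≤ ⁅D.stab, D.stab⁆}
    {w : ZMod p → ZMod p} (hw : w ∈ D.thetaImage T hT) :
    (fun k => w (k + 1)) ∈ D.thetaImage T hT := by
  obtain ⟨g, hg, rfl⟩ := hw
  refine ⟨_, hN.conj_mem g hg D.a⁻¹, funext fun k => ?_⟩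
  rw [thetaSec, D.sec_conj_a g (D.mem_commutator_stab_iff.1 (hT hg)).1]
  rfl

/-- The c-exponent of a commutator of sections involves rotations and b-exponents, and the former
are convolutions of the latter with E; hence a bilinear form in the b-exponents. -/
theorem moment_thetaSec_commutator {g h : G} (hg : g ∈ D.stab) (hh : h ∈ D.stab) (n : ℕ) :
    moment p n (D.thetaSec ⁅g, h⁆) = ∑ i, ∑ j,
      D.bexp (D.sec g i) * D.bexp (D.sec h j) * commutatorForm E n i j := by
  have h1 : ∀ k, D.thetaSec ⁅g, h⁆ k = (∑ i, E (k - i) * D.bexp (D.sec g i)) * D.bexp (D.sec h k)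
      - (∑ i, E (k - i) * D.bexp (D.sec h i)) * D.bexp (D.sec g k) := by
    intro k
    rw [thetaSec, D.sec_commutator hg hh, theta_commutator, D.lvl_sec_eq_sum hg,
      D.lvl_sec_eq_sum hh]
  simp only [moment_apply, h1, mul_sub, Finset.sum_sub_distrib, commutatorForm,
    Finset.sum_mul, Finset.mul_sum]
  congr 1
  · rw [Finset.sum_comm]
    exact Finset.sum_congr rfl fun i _ => Finset.sum_congr rfl fun j _ => by ring
  · exact Finset.sum_congr rfl fun i _ => Finset.sum_congr rfl fun j _ => by ring

theorem moment_thetaImage_eq_zero {A : Subgroup G} (hT : ⁅A, A⁆ ≤ ⁅D.stab, D.stab⁆) {n : ℕ}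
    (h : ∀ x ∈ A, ∀ y ∈ A, moment p n (D.thetaSec ⁅x, y⁆) = 0) {w : ZMod p → ZMod p}
    (hw : w ∈ D.thetaImage ⁅A, A⁆ hT) : moment p n w = 0 := by
  obtain ⟨g, hg, rfl⟩ := hw
  suffices hs : g ∈ ⁅D.stab, D.stab⁆ ∧ moment p n (D.thetaSec g) = 0 from hs.2
  have hg' := hg
  rw [Subgroup.commutator_def] at hg'
  refine Subgroup.closure_induction (p := fun g _ => g ∈ ⁅D.stab, D.stab⁆ ∧
    moment p n (D.thetaSec g) = 0) ?_ ?_ ?_ ?_ hg'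
  · rintro _ ⟨x, hx, y, hy, rfl⟩
    exact ⟨hT (Subgroup.commutator_mem_commutator hx hy), h x hx y hy⟩
  · exact ⟨one_mem _, by rw [thetaSec_one, map_zero]⟩
  · rintro x y _ _ ⟨h1, h2⟩ ⟨h3, h4⟩
    exact ⟨mul_mem h1 h3, by rw [D.thetaSec_mul _ h3, map_add, h2, h4, add_zero]⟩
  · rintro x _ ⟨h1, h2⟩
    exact ⟨inv_mem h1, by rw [D.thetaSec_inv h1, map_neg, h2, neg_zero]⟩

theorem moment_thetaSec_conjB (n : ℕ) (i j : ZMod p) :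
    moment p n (D.thetaSec ⁅D.conjB i, D.conjB j⁆) = commutatorForm E n i j := by
  rw [D.moment_thetaSec_commutator (D.conjB_mem_stab i) (D.conjB_mem_stab j)]
  simp [bexp_sec_conjB]

theorem commutator_le_commutator_stab : ⁅commutator G, commutator G⁆ ≤ ⁅D.stab, D.stab⁆ :=
  Subgroup.commutator_mono D.commutator_le_stab D.commutator_le_stab

theorem moment_stab_iff (n : ℕ) :
    (∀ w ∈ D.thetaImage ⁅D.stab, D.stab⁆ le_rfl, moment p n w = 0) ↔
      ∀ i j, commutatorForm E n i j = 0 := by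
  constructor
  · intro h i j
    rw [← D.moment_thetaSec_conjB]
    exact h _ ⟨_, Subgroup.commutator_mem_commutator (D.conjB_mem_stab i) (D.conjB_mem_stab j), rfl⟩
  · intro h w hw
    refine D.moment_thetaImage_eq_zero le_rfl (fun x hx y hy => ?_) hw
    rw [D.moment_thetaSec_commutator hx hy]
    simp [h]

/-- For elements of G' the b-exponents of the sections sum to zero. On such vectors a form with zero
entry at (0, 0) vanishes exactly when it splits as a function of i plus a function of j. -/
theorem moment_commutator_iff (n : ℕ) :
    (∀ w ∈ D.thetaImage ⁅commutator G, commutator G⁆ D.commutator_le_commutator_stab,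
      moment p n w = 0) ↔
      ∀ i j, commutatorForm E n i j = commutatorForm E n i 0 + commutatorForm E n 0 j := by
  constructor
  · intro h i j
    have h1 := h _ ⟨_, Subgroup.commutator_mem_commutator (D.conjB_mul_inv_mem i 0)
      (D.conjB_mul_inv_mem j 0), rfl⟩
    have h0 : D.lvl (D.conjB 0)⁻¹ = 0 := by rw [lvl_inv, lvl_conjB, neg_zero]
    rw [D.moment_thetaSec_commutator (D.commutator_le_stab (D.conjB_mul_inv_mem _ _))
      (D.commutator_le_stab (D.conjB_mul_inv_mem _ _))] at h1
    simp only [D.sec_mul_of_lvl _ h0, D.sec_inv_of_lvl (D.lvl_conjB 0), bexp_mul, bexp_inv,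
      bexp_sec_conjB] at h1
    have h00 : commutatorForm E n 0 0 = 0 := sub_self _
    simp only [add_mul, mul_add, Finset.sum_add_distrib, neg_mul, mul_neg,
      Finset.sum_neg_distrib, ite_mul, mul_ite, one_mul, mul_one, zero_mul, mul_zero,
      Finset.sum_ite_eq', Finset.mem_univ, if_true, h00, neg_zero] at h1
    linear_combination h1
  · intro h w hw
    refine D.moment_thetaImage_eq_zero _ (fun x hx y hy => ?_) hw
    rw [D.moment_thetaSec_commutator (D.commutator_le_stab hx) (D.commutator_le_stab hy)]
    have hx0 : ∑ i, D.bexp (D.sec x i) = 0 := by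
      rw [sum_bexp_sec]; exact (D.mem_commutator_iff.1 hx).2
    have hy0 : ∑ i, D.bexp (D.sec y i) = 0 := by
      rw [sum_bexp_sec]; exact (D.mem_commutator_iff.1 hy).2
    calc _ = (∑ i, D.bexp (D.sec x i) * commutatorForm E n i 0) * ∑ j, D.bexp (D.sec y j) +
          (∑ i, D.bexp (D.sec x i)) * ∑ j, D.bexp (D.sec y j) * commutatorForm E n 0 j := by
          simp only [Finset.sum_mul, Finset.mul_sum, ← Finset.sum_add_distrib]
          rw [Finset.sum_comm]
          exact Finset.sum_congr rfl fun i _ => Finset.sum_congr rfl fun j _ => by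
            rw [h]; ring
      _ = 0 := by rw [hx0, hy0]; ring

-- In the symmetric case the moment of order 0 vanishes, but [b_0, b_m] has first moment m E m,
-- non-zero for suitable m.
open Classical in
theorem thetaImage_stab : D.thetaImage ⁅D.stab, D.stab⁆ le_rfl =
    momentKer p (if ∀ x, E (-x) = E x then 1 else 0) := by
  split_ifs with h
  · obtain ⟨m, hm⟩ := D.exists_E_ne_zero
    have hm0 : m ≠ 0 := fun h => hm (by rw [h, D.E_zero])
    have h1 := (D.moment_stab_iff 0).2 (commutatorForm_zero_eq_zero_iff.2 h)
    refine eq_momentKer (fun _ => D.thetaImage_shift) one_le_two D.odd ?_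
      ⟨_, Subgroup.commutator_mem_commutator (D.conjB_mem_stab 0) (D.conjB_mem_stab m), rfl⟩ ?_
    · intro w hw i hi
      obtain rfl : i = 0 := by omega
      exact h1 w hw
    · rw [moment_thetaSec_conjB, commutatorForm]
      simpa using ⟨hm0, hm⟩
  · rw [← commutatorForm_zero_eq_zero_iff, ← D.moment_stab_iff] at h
    push Not at h
    obtain ⟨w, hw, hw0⟩ := h
    exact eq_momentKer (fun _ => D.thetaImage_shift) zero_le_two D.odd
      (fun _ _ i hi => absurd hi (Nat.not_lt_zero _)) hw hw0

open Classical in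
theorem thetaImage_commutator :
    D.thetaImage ⁅commutator G, commutator G⁆ D.commutator_le_commutator_stab =
      momentKer p ((if ∃ s t, ∀ x, x ≠ 0 → E x = s * x + t then 1 else 0) +
        if ∃ l, ∀ x, E x - E (-x) = l * x then 1 else 0) := by
  have hsh : ∀ w ∈ D.thetaImage ⁅commutator G, commutator G⁆ D.commutator_le_commutator_stab,
    (fun k => w (k + 1)) ∈ D.thetaImage ⁅commutator G, commutator G⁆
      D.commutator_le_commutator_stab := fun _ => D.thetaImage_shift
  by_cases h0 : ∃ l, ∀ x, E x - E (-x) = l * x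
  · have h0' := (D.moment_commutator_iff 0).2 (commutatorForm_zero_eq_add_iff.2 h0)
    by_cases h1 : ∃ s t, ∀ x, x ≠ 0 → E x = s * x + t
    · rw [if_pos h0, if_pos h1]
      have h1' := (D.moment_commutator_iff 1).2
        ((commutatorForm_one_eq_add_iff D.odd h0).2 h1)
      have h2 := not_commutatorForm_two_eq_add D.odd D.E_nonconst h1
      rw [← D.moment_commutator_iff] at h2
      push Not at h2
      obtain ⟨w, hw, hw0⟩ := h2
      refine eq_momentKer hsh le_rfl D.odd (fun w hw i hi => ?_) hw hw0
      interval_cases i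
      exacts [h0' w hw, h1' w hw]
    · rw [if_pos h0, if_neg h1]
      rw [← commutatorForm_one_eq_add_iff D.odd h0, ← D.moment_commutator_iff] at h1
      push Not at h1
      obtain ⟨w, hw, hw0⟩ := h1
      refine eq_momentKer hsh one_le_two D.odd (fun w hw i hi => ?_) hw hw0
      obtain rfl : i = 0 := by omega
      exact h0' w hw
  -- An affine tuple has linear odd part, so the first summand vanishes together with the second.
  · rw [if_neg h0, if_neg fun h => h0 (exists_of_affine D.E_zero h)]
    rw [← commutatorForm_zero_eq_add_iff, ← D.moment_commutator_iff] at h0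
    push Not at h0
    obtain ⟨w, hw, hw0⟩ := h0
    exact eq_momentKer hsh zero_le_two D.odd
      (fun _ _ i hi => absurd hi (Nat.not_lt_zero _)) hw hw0

end GGSData

/-! ### Self-similarity of the derived series and the indices -/

namespace GGSData

variable {p : ℕ} [Fact p.Prime] {E : ZMod p → ZMod p} {G : Type*} [Group G] (D : GGSData p E G)

/-- The elements of the first level stabilizer all of whose sections lie in `N`. -/
def secComap (N : Subgroup G) : Subgroup G :=
  ((Subgroup.pi Set.univ fun _ => N).comap D.secHom).map D.stab.subtype

theorem mem_secComap {N : Subgroup G} {g : G} :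
    g ∈ D.secComap N ↔ D.lvl g = 0 ∧ ∀ k, D.sec g k ∈ N := by
  constructor
  · rintro ⟨g, hg, rfl⟩
    exact ⟨g.2, fun k => hg k trivial⟩
  · rintro ⟨h0, h⟩
    exact ⟨⟨g, h0⟩, fun k _ => h k, rfl⟩

theorem secComap_mono {N M : Subgroup G} (h : N ≤ M) : D.secComap N ≤ D.secComap M := by
  intro g hg
  rw [mem_secComap] at hg ⊢
  exact ⟨hg.1, fun k => h (hg.2 k)⟩

theorem secComap_le {N T : Subgroup G} (h : N ≤ D.rist T) : D.secComap N ≤ T := by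
  intro g hg
  obtain ⟨h0, hs⟩ := D.mem_secComap.1 hg
  obtain ⟨g', hg', h0', hs'⟩ := D.exists_sec_eq_of_mem_rist fun k => h (hs k)
  rwa [D.eq_of_sec_eq (h0.trans h0'.symm) fun k => (congrFun hs' k).symm]

theorem commutator_le_secComap {A N : Subgroup G} (hA : A ≤ D.secComap N) :
    ⁅A, A⁆ ≤ D.secComap ⁅N, N⁆ := by
  rw [Subgroup.commutator_le]
  intro g hg h hh
  obtain ⟨hg0, hgs⟩ := D.mem_secComap.1 (hA hg)
  obtain ⟨hh0, hhs⟩ := D.mem_secComap.1 (hA hh)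
  refine D.mem_secComap.2 ⟨D.lvl_commutator _ _, fun k => ?_⟩
  rw [D.sec_commutator hg0 hh0]
  exact Subgroup.commutator_mem_commutator (hgs k) (hhs k)

theorem commutator_mem_rist_of_sec {A : Subgroup G} [A.Normal] {x v : G} (hx : x ∈ A)
    (hx0 : D.lvl x = 0) (hv : v ∈ D.rist A) : ⁅D.sec x 0, v⁆ ∈ D.rist ⁅A, A⁆ := by
  obtain ⟨h, hh, hh0, hhs⟩ := D.mem_rist.1 hv 0
  refine D.mem_rist_of_sec_eq (g := ⁅x, h⁆) (k := 0) (Subgroup.commutator_mem_commutator hx hh)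
    (D.lvl_commutator _ _) (funext fun k => ?_)
  rw [D.sec_commutator hx0 hh0, hhs, Pi.mulSingle_apply, Pi.mulSingle_apply]
  split_ifs with hk
  · rw [hk]
  · rw [commutatorElement_one_right]

instance (N : Subgroup G) [hN : N.Normal] : (D.secComap N).Normal := by
  refine ⟨fun g hg h => ?_⟩
  obtain ⟨h0, hs⟩ := D.mem_secComap.1 hg
  refine D.mem_secComap.2 ⟨by rw [lvl_conj, h0], fun k => ?_⟩
  rw [D.sec_conj h0]
  exact hN.conj_mem _ (hs _) _

/-- The hypothesis makes `secComap N` the full direct power of N, whose derived subgroup is taken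
coordinatewise. -/
theorem commutator_secComap {N : Subgroup G} [N.Normal] (hN : N ≤ D.rist ⊤) :
    ⁅D.secComap N, D.secComap N⁆ = D.secComap ⁅N, N⁆ := by
  have hN' : N ≤ D.rist (D.secComap N) := by
    intro u hu
    obtain ⟨g, -, hg0, hgs⟩ := D.mem_rist.1 (hN hu) 0
    refine D.mem_rist_of_sec_eq (D.mem_secComap.2 ⟨hg0, fun k => ?_⟩) hg0 hgs
    rw [hgs, Pi.mulSingle_apply]
    split_ifs
    exacts [hu, one_mem _]
  refine le_antisymm (D.commutator_le_secComap le_rfl) (D.secComap_le ?_)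
  rw [Subgroup.commutator_le]
  intro u hu v hv
  obtain ⟨g, hg, hg0, hgs⟩ := D.mem_rist.1 (hN' hu) 0
  have := D.commutator_mem_rist_of_sec hg hg0 (hN' hv)
  rwa [hgs, Pi.mulSingle_eq_same] at this

-- G'/γ₃ is generated by the image of c. Modulo [G', γ₃] the subgroup γ₃ commutes with G', so G'
-- becomes abelian.
include D in
theorem commutator_commutator_le : ⁅commutator G, commutator G⁆ ≤ ⁅commutator G, gamma₃ G⁆ := by
  set N := ⁅commutator G, gamma₃ G⁆ with hN
  set f := QuotientGroup.mk' N with hf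
  have h1 : ∀ x ∈ commutator G, ∀ z ∈ gamma₃ G, Commute (f x) (f z) := by
    intro x hx z hz
    rw [commute_iff_eq, ← commutatorElement_eq_one_iff_mul_comm, ← map_commutatorElement,
      ← MonoidHom.mem_ker, QuotientGroup.ker_mk']
    exact Subgroup.commutator_mem_commutator hx hz
  have h2 : ∀ x ∈ commutator G, Commute (f x) (f D.c) := by
    intro x hx
    have h3 := (h1 _ D.c_mem _ (D.c_pow_inv_mul_mem hx)).symm
    have h4 := ((Commute.refl (f D.c)).pow_left (D.theta x).val).mul_left h3
    rwa [← map_pow, ← map_mul, mul_inv_cancel_left] at h4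
  rw [Subgroup.commutator_le]
  intro x hx y hy
  have h3 := ((h2 x hx).pow_right (D.theta y).val).mul_right (h1 _ hx _ (D.c_pow_inv_mul_mem hy))
  rw [← map_pow, ← map_mul, mul_inv_cancel_left] at h3
  rw [← QuotientGroup.ker_mk' N, MonoidHom.mem_ker, map_commutatorElement,
    commutatorElement_eq_one_iff_mul_comm]
  exact h3

include D in
theorem const_mem_momentKer {d : ℕ} (hd : d ≤ 2) (x : ZMod p) :
    (fun _ => x) ∈ momentKer p d := by
  have h0 : ∑ k : ZMod p, k = 0 := by
    have h1 : ∑ k : ZMod p, k = ∑ k : ZMod p, -k :=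
      (Fintype.sum_equiv (Equiv.neg (ZMod p)) _ _ fun k => rfl).symm
    rw [Finset.sum_neg_distrib] at h1
    have h2 : (2 : ZMod p) * ∑ k : ZMod p, k = 0 := by linear_combination h1
    exact (mul_eq_zero.1 h2).resolve_left (ZMod.two_ne_zero_of_ne D.odd)
  intro i hi
  have : i = 0 ∨ i = 1 := by omega
  rcases this with rfl | rfl
  · simp [moment_apply]
  · simp [moment_apply, ← Finset.sum_mul, h0]

/-- Constant functions lie in every `momentKer` that can occur, so an element of G'' has section u
at 0 modulo γ₃; the rest is corrected by `gamma₃_le_rist`. -/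
theorem exists_sec_zero_eq {u : G} (hu : u ∈ commutator G) :
    ∃ g ∈ ⁅commutator G, commutator G⁆, D.lvl g = 0 ∧ D.sec g 0 = u := by
  classical
  have hd : (if ∃ s t, ∀ x, x ≠ 0 → E x = s * x + t then 1 else 0) +
      (if ∃ l, ∀ x, E x - E (-x) = l * x then 1 else 0) ≤ 2 := by split_ifs <;> simp
  have hmem := D.const_mem_momentKer hd (D.theta u)
  rw [← D.thetaImage_commutator, mem_thetaImage] at hmem
  obtain ⟨g, hg, hgs⟩ := hmem
  have hg0 := (D.mem_commutator_stab_iff.1 (D.commutator_le_commutator_stab hg)).1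
  have hsec := D.sec_mem_commutator (D.commutator_le_commutator_stab hg) 0
  obtain ⟨h, hh, hh0, hhs⟩ := D.mem_rist.1 (D.gamma₃_le_rist
    (D.inv_mul_mem_gamma₃ hsec hu (congrFun hgs 0))) 0
  refine ⟨g * h, mul_mem hg hh, by rw [D.lvl_mul, hg0, hh0, add_zero], ?_⟩
  rw [D.sec_mul_of_lvl _ hh0, hhs, Pi.mulSingle_eq_same, mul_inv_cancel_left]

/-- In the base case G'' ≤ [G', γ₃]. An element u of G' is a section of some element of G'', and v
in γ₃ is the only section of another; their commutator in G''' has [u, v] as its only section. -/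
theorem derivedSeries_succ_eq (n : ℕ) :
    derivedSeries G (n + 3) = D.secComap (derivedSeries G (n + 2)) := by
  have h2 : derivedSeries G 2 = ⁅commutator G, commutator G⁆ := by
    rw [derivedSeries_succ, derivedSeries_one]
  have hle : ⁅commutator G, commutator G⁆ ≤ gamma₃ G := Subgroup.commutator_mono le_rfl le_top
  induction n with
  | zero =>
    rw [zero_add, zero_add, derivedSeries_succ, h2]
    refine le_antisymm (D.commutator_le_secComap fun g hg => ?_)
      (D.secComap_le ((D.commutator_commutator_le).trans ?_))
    · exact D.mem_secComap.2
        ⟨(D.mem_commutator_stab_iff.1 (D.commutator_le_commutator_stab hg)).1,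
          D.sec_mem_commutator (D.commutator_le_commutator_stab hg)⟩
    · rw [Subgroup.commutator_le]
      intro u hu v hv
      obtain ⟨g, hg, hg0, rfl⟩ := D.exists_sec_zero_eq hu
      exact D.commutator_mem_rist_of_sec hg hg0 (D.gamma₃_le_rist hv)
  | succ n ih =>
    have h4 : derivedSeries G (n + 3) = ⁅derivedSeries G (n + 2), derivedSeries G (n + 2)⁆ :=
      derivedSeries_succ G (n + 2)
    have h5 : derivedSeries G (n + 1 + 3) = ⁅derivedSeries G (n + 3), derivedSeries G (n + 3)⁆ :=
      derivedSeries_succ G (n + 3)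
    rw [h5, ih, D.commutator_secComap, ← h4, ih]
    exact ((derivedSeries_antitone G (show 2 ≤ n + 2 by omega)).trans (h2.le.trans hle)).trans
      (D.gamma₃_le_rist.trans (D.rist_mono le_top))

theorem relIndex_secComap {N K : Subgroup G} [N.Normal] (hK : K ≤ D.rist ⊤) :
    (D.secComap N).relIndex (D.secComap K) = N.relIndex K ^ p := by
  let f : D.secComap K →* (ZMod p → K ⧸ N.subgroupOf K) :=
    { toFun := fun g k => QuotientGroup.mk' _ ⟨D.sec g k, (D.mem_secComap.1 g.2).2 k⟩
      map_one' := funext fun k => by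
        rw [Pi.one_apply, ← map_one (QuotientGroup.mk' (N.subgroupOf K))]
        exact congrArg _ (Subtype.ext (D.sec_one k))
      map_mul' := fun g h => funext fun k => by
        rw [Pi.mul_apply, ← map_mul]
        exact congrArg _ (Subtype.ext (D.sec_mul_of_lvl _ (D.mem_secComap.1 h.2).1 k)) }
  have hk : (D.secComap N).subgroupOf (D.secComap K) = f.ker := by
    ext g
    rw [Subgroup.mem_subgroupOf, mem_secComap, MonoidHom.mem_ker, funext_iff]
    have h1 : ∀ k, f g k = 1 ↔ D.sec g k ∈ N := fun k => by
      change QuotientGroup.mk' _ _ = 1 ↔ _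
      rw [← MonoidHom.mem_ker, QuotientGroup.ker_mk', Subgroup.mem_subgroupOf]
    exact ⟨fun h k => (h1 k).2 (h.2 k), fun h => ⟨(D.mem_secComap.1 g.2).1, fun k => (h1 k).1 (h k)⟩⟩
  have hs : f.range = ⊤ := by
    rw [MonoidHom.range_eq_top]
    intro x
    choose y hy using fun k => QuotientGroup.mk'_surjective (N.subgroupOf K) (x k)
    obtain ⟨g, -, hg0, hgs⟩ := D.exists_sec_eq_of_mem_rist (f := fun k => (y k : G))
      fun k => hK (y k).2
    refine ⟨⟨g, D.mem_secComap.2 ⟨hg0, fun k => ?_⟩⟩, funext fun k => ?_⟩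
    · rw [hgs]; exact (y k).2
    · rw [← hy]
      exact congrArg _ (Subtype.ext (congrFun hgs k))
  rw [Subgroup.relIndex, hk, Subgroup.index_ker, hs, Subgroup.card_top, Nat.card_fun,
    Nat.card_zmod]
  rfl

/-- The sections of T lie in G', where the exponent of c detects γ₃. -/
theorem relIndex_secComap_gamma₃ {T : Subgroup G} (hT : T ≤ ⁅D.stab, D.stab⁆) :
    (D.secComap (gamma₃ G)).relIndex T = Nat.card (D.thetaImage T hT) := by
  let f : T →* Multiplicative (ZMod p → ZMod p) :=
    { toFun := fun g => Multiplicative.ofAdd (D.thetaSec g)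
      map_one' := by rw [Subgroup.coe_one, thetaSec_one]; rfl
      map_mul' := fun g h => by rw [Subgroup.coe_mul, D.thetaSec_mul _ (hT h.2)]; rfl }
  have hk : (D.secComap (gamma₃ G)).subgroupOf T = f.ker := by
    ext g
    rw [Subgroup.mem_subgroupOf, mem_secComap, MonoidHom.mem_ker]
    have hg := hT g.2
    constructor
    · intro h
      exact congrArg Multiplicative.ofAdd (funext fun k => (D.mem_gamma₃_iff.1 (h.2 k)).2.2)
    · intro h
      refine ⟨(D.mem_commutator_stab_iff.1 hg).1, fun k => ?_⟩
      have h1 := D.mem_commutator_iff.1 (D.sec_mem_commutator hg k)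
      exact D.mem_gamma₃_iff.2 ⟨h1.1, h1.2, congrFun (Multiplicative.ofAdd.injective h) k⟩
  rw [Subgroup.relIndex, hk, Subgroup.index_ker]
  refine Nat.card_congr (Equiv.subtypeEquiv Multiplicative.toAdd fun x => ?_)
  rw [mem_thetaImage]
  exact ⟨fun ⟨g, hg⟩ => ⟨g, g.2, congrArg Multiplicative.toAdd hg⟩,
    fun ⟨g, hg, h⟩ => ⟨⟨g, hg⟩, congrArg Multiplicative.ofAdd h⟩⟩

include D in
open Classical in
/-- The exponents of the indices of the derived series. -/
theorem index_derivedSeries (n : ℕ) : ∃ l : ℕ, (derivedSeries G (n + 2)).index = p ^ l ∧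
    (l : ℝ) = (p : ℝ) ^ n * (p + ((if ∃ s t, ∀ x, x ≠ 0 → E x = s * x + t then 1 else 0 : ℕ) : ℝ) +
        ((if ∃ l, ∀ x, E x - E (-x) = l * x then 1 else 0 : ℕ) : ℝ))
      - ((p : ℝ) ^ (n + 1) - 1) / ((p : ℝ) - 1) *
        ((if ∀ x, E (-x) = E x then 1 else 0 : ℕ) : ℝ) + 1 := by
  have hcardG := D.relIndex_secComap_gamma₃ D.commutator_le_commutator_stab
  have hcardS := D.relIndex_secComap_gamma₃ le_rfl
  rw [thetaImage_commutator] at hcardG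
  rw [thetaImage_stab] at hcardS
  set dc : ℕ := if ∃ s t, ∀ x, x ≠ 0 → E x = s * x + t then 1 else 0 with hdc
  set ds : ℕ := if ∃ l, ∀ x, E x - E (-x) = l * x then 1 else 0 with hds
  set d : ℕ := if ∀ x, E (-x) = E x then 1 else 0 with hd
  have hdc1 : dc ≤ 1 := by rw [hdc]; split_ifs <;> simp
  have hds1 : ds ≤ 1 := by rw [hds]; split_ifs <;> simp
  have hd1 : d ≤ 1 := by rw [hd]; split_ifs <;> simp
  have hp := (Fact.out : p.Prime)
  have hA := card_momentKer (p := p) (d := dc + ds) (by omega)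
  have hB := card_momentKer (p := p) (d := d) (by omega)
  rw [← hcardG] at hA
  rw [← hcardS] at hB
  have hGS := Subgroup.relIndex_mul_relIndex (D.secComap (gamma₃ G)) ⁅commutator G, commutator G⁆
    ⁅D.stab, D.stab⁆ (D.secComap_le D.gamma₃_le_rist) D.commutator_le_commutator_stab
  have hS : ⁅D.stab, D.stab⁆.index = p ^ (p + 1) := by
    rw [← Subgroup.relIndex_mul_index (Subgroup.commutator_le_left _ _ : ⁅D.stab, D.stab⁆ ≤ D.stab),
      D.relIndex_commutator_stab, D.index_stab, pow_succ]
  have hG := Subgroup.relIndex_mul_index D.commutator_le_commutator_stab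
  rw [hS] at hG
  have h2 : derivedSeries G 2 = ⁅commutator G, commutator G⁆ := by
    rw [derivedSeries_succ, derivedSeries_one]
  have hp1 : (p : ℝ) - 1 ≠ 0 := by
    have : (1 : ℝ) < p := by exact_mod_cast hp.one_lt
    linarith
  -- With L = `D.secComap (gamma₃ G)`: |G : G''| |K' : L| = |G : K'| |G'' : L|, and the two indices
  -- of L are p^(p-d) and p^(p-dc-ds).
  have hidx : (derivedSeries G 2).index = p ^ (p + 1 + dc + ds - d) := by
    rw [h2]
    refine Nat.eq_of_mul_eq_mul_right (pow_pos hp.pos (p + d)) ?_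
    calc _ = ((D.secComap (gamma₃ G)).relIndex ⁅commutator G, commutator G⁆ *
          ⁅commutator G, commutator G⁆.relIndex ⁅D.stab, D.stab⁆) * p ^ d * p ^ (dc + ds) *
          p ^ (p + 1) := by
          rw [pow_add p p d, ← hA, ← hG]; ring
      _ = p ^ p * p ^ (dc + ds) * p ^ (p + 1) := by rw [hGS, hB]
      _ = _ := by rw [← pow_add, ← pow_add, ← pow_add]; congr 1; omega
  have hle : ∀ n, derivedSeries G (n + 2) ≤ gamma₃ G := fun n =>
    (derivedSeries_antitone G (show 2 ≤ n + 2 by omega)).trans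
      (h2.le.trans (Subgroup.commutator_mono le_rfl le_top))
  -- Along G ≥ K' ≥ L ≥ G^(n+3) the exponents are p + 1, p - d and p (l - 3); the last is p times
  -- that of |γ₃ : G^(n+2)|, as |G : γ₃| = p^3.
  have hstep : ∀ n l, (derivedSeries G (n + 2)).index = p ^ l →
      3 ≤ l ∧ (derivedSeries G (n + 3)).index = p ^ (p * (l - 3) + (p - d) + (p + 1)) := by
    intro n l hl
    have h3 := Subgroup.relIndex_mul_index (hle n)
    rw [D.index_gamma₃, hl] at h3
    have hl3 : 3 ≤ l := (Nat.pow_dvd_pow_iff_le_right hp.one_lt).1 ⟨_, by rw [← h3, mul_comm]⟩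
    refine ⟨hl3, ?_⟩
    have h4 : (derivedSeries G (n + 2)).relIndex (gamma₃ G) = p ^ (l - 3) := by
      refine Nat.eq_of_mul_eq_mul_right (pow_pos hp.pos 3) ?_
      rw [h3, ← pow_add]; congr 1; omega
    have h5 : (D.secComap (gamma₃ G)).relIndex ⁅D.stab, D.stab⁆ = p ^ (p - d) := by
      refine Nat.eq_of_mul_eq_mul_right (pow_pos hp.pos d) ?_
      have := hp.two_le
      rw [hB, ← pow_add]; congr 1; omega
    have h6 := Subgroup.relIndex_mul_index ((D.secComap_le D.gamma₃_le_rist).trans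
      D.commutator_le_commutator_stab)
    rw [h5, hS] at h6
    rw [← Subgroup.relIndex_mul_index
      ((D.derivedSeries_succ_eq n).le.trans (D.secComap_mono (hle n))), ← h6,
      D.derivedSeries_succ_eq n,
      D.relIndex_secComap (D.gamma₃_le_rist.trans (D.rist_mono le_top)), h4, ← pow_mul,
      ← pow_add, ← pow_add]
    congr 1; ring
  induction n with
  | zero =>
    refine ⟨_, hidx, ?_⟩
    rw [Nat.cast_sub (by omega)]
    push_cast
    field_simp
    ring
  | succ n ih =>
    obtain ⟨l, hl, hlr⟩ := ih
    obtain ⟨hl3, h⟩ := hstep n l hl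
    refine ⟨_, h, ?_⟩
    have := hp.two_le
    rw [Nat.cast_add, Nat.cast_add, Nat.cast_mul, Nat.cast_sub hl3, Nat.cast_sub (by omega), hlr]
    push_cast
    field_simp
    ring

end GGSData

/-! ### The GGS-group of the tree as an instance of the abstract structure -/

section TreeSections

variable {p : ℕ} [Fact p.Prime] (e : Fin (p - 1) → ZMod p)

/-- The defining tuple as a function on `ZMod p`, with value `0` at `0`. -/
def tupleExtension (x : ZMod p) : ZMod p := if hx : x = 0 then 0 else tupleEntry e x hx

theorem directedGen_cons_of_ne {x : ZMod p} (hx : x ≠ 0) (w : TreeVertex p) :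
    directedGen e (x :: w) = x :: (rootedGen p ^ (tupleExtension e x).val) w := by
  rw [directedGen_cons e x hx, tupleExtension, dif_neg hx]

theorem rootedGen_cons (x : ZMod p) (w : TreeVertex p) :
    rootedGen p (x :: w) = (x + 1) :: w := rfl

theorem rootedGen_mem : rootedGen p ∈ GGSGroup e := Subgroup.subset_closure (by simp)

theorem directedGen_mem : directedGen e ∈ GGSGroup e := Subgroup.subset_closure (by simp)

/-- The rooted generator as an element of the GGS-group. -/
def GGSGroup.a : GGSGroup e := ⟨rootedGen p, rootedGen_mem e⟩

/-- The directed generator as an element of the GGS-group. -/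
def GGSGroup.b : GGSGroup e := ⟨directedGen e, directedGen_mem e⟩

theorem exists_sections (g : GGSGroup e) : ∃ (t : ZMod p) (h : ZMod p → GGSGroup e),
    g.1 [] = [] ∧ ∀ x w, g.1 (x :: w) = (x + t) :: (h x).1 w := by
  obtain ⟨g, hg⟩ := g
  refine Subgroup.closure_induction (p := fun g _ => ∃ (t : ZMod p) (h : ZMod p → GGSGroup e),
    g [] = [] ∧ ∀ x w, g (x :: w) = (x + t) :: (h x).1 w) ?_ ?_ ?_ ?_ hg
  · rintro _ (rfl | rfl)
    · exact ⟨1, 1, rfl, fun x w => rfl⟩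
    · refine ⟨0, fun x => if x = 0 then GGSGroup.b e else GGSGroup.a e ^ (tupleExtension e x).val,
        rfl, fun x w => ?_⟩
      by_cases hx : x = 0
      · subst hx
        simp only [if_true]
        rw [directedGen_cons_zero, add_zero]; rfl
      · simp only [if_neg hx]
        rw [directedGen_cons_of_ne e hx, add_zero]; rfl
  · exact ⟨0, 1, rfl, fun x w => by rw [add_zero]; rfl⟩
  · rintro g h _ _ ⟨t, s, h1, h2⟩ ⟨t', s', h1', h2'⟩
    refine ⟨t' + t, fun x => s (x + t') * s' x, ?_, fun x w => ?_⟩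
    · rw [RelIso.mul_apply, h1', h1]
    · rw [RelIso.mul_apply, h2', h2, add_assoc]; rfl
  · rintro g _ ⟨t, s, h1, h2⟩
    refine ⟨-t, fun x => (s (x + -t))⁻¹, ?_, fun x w => ?_⟩
    · apply g.injective
      rw [RelIso.apply_inv_self, h1]
    · apply g.injective
      rw [RelIso.apply_inv_self, h2, neg_add_cancel_right]
      congr 1
      exact (RelIso.apply_inv_self (s (x + -t)).1 w).symm

/-- The rotation of the first level induced by an element of the GGS-group. -/
noncomputable def GGSGroup.lvl (g : GGSGroup e) : ZMod p := (exists_sections e g).choose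

/-- The sections of an element of the GGS-group at the vertices of the first level. -/
noncomputable def GGSGroup.sec (g : GGSGroup e) : ZMod p → GGSGroup e :=
  (exists_sections e g).choose_spec.choose

theorem GGSGroup.apply_nil (g : GGSGroup e) : g.1 [] = [] :=
  (exists_sections e g).choose_spec.choose_spec.1

theorem GGSGroup.apply_cons (g : GGSGroup e) (x : ZMod p) (w : TreeVertex p) :
    g.1 (x :: w) = (x + GGSGroup.lvl e g) :: (GGSGroup.sec e g x).1 w :=
  (exists_sections e g).choose_spec.choose_spec.2 x w

/-- Level and sections are obtained by choice; uniqueness is what makes them computable. -/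
theorem GGSGroup.lvl_sec_unique {g : GGSGroup e} {t : ZMod p} {h : ZMod p → GGSGroup e}
    (H : ∀ x w, g.1 (x :: w) = (x + t) :: (h x).1 w) :
    GGSGroup.lvl e g = t ∧ ∀ x, GGSGroup.sec e g x = h x := by
  have h1 : ∀ x w, (x + GGSGroup.lvl e g) :: (GGSGroup.sec e g x).1 w = (x + t) :: (h x).1 w :=
    fun x w => by rw [← GGSGroup.apply_cons, H]
  refine ⟨add_left_cancel (List.cons.inj (h1 0 [])).1, fun x => Subtype.ext ?_⟩
  exact RelIso.ext fun w => (List.cons.inj (h1 x w)).2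

theorem GGSGroup.mul_unique (g h : GGSGroup e) :
    GGSGroup.lvl e (g * h) = GGSGroup.lvl e g + GGSGroup.lvl e h ∧
      ∀ x, GGSGroup.sec e (g * h) x =
        GGSGroup.sec e g (x + GGSGroup.lvl e h) * GGSGroup.sec e h x := by
  refine GGSGroup.lvl_sec_unique e fun x w => ?_
  rw [Subgroup.coe_mul, RelIso.mul_apply, GGSGroup.apply_cons e h, GGSGroup.apply_cons e g,
    add_assoc, add_comm (GGSGroup.lvl e h)]
  rfl

theorem GGSGroup.lvl_sec_a :
    GGSGroup.lvl e (GGSGroup.a e) = 1 ∧ ∀ x, GGSGroup.sec e (GGSGroup.a e) x = 1 :=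
  GGSGroup.lvl_sec_unique e (h := fun _ => 1) fun _ _ => rfl

theorem GGSGroup.lvl_sec_b : GGSGroup.lvl e (GGSGroup.b e) = 0 ∧
    ∀ x, GGSGroup.sec e (GGSGroup.b e) x =
      if x = 0 then GGSGroup.b e else GGSGroup.a e ^ (tupleExtension e x).val := by
  refine GGSGroup.lvl_sec_unique e fun x w => ?_
  by_cases hx : x = 0
  · subst hx
    rw [if_pos rfl, add_zero]
    exact directedGen_cons_zero e w
  · rw [if_neg hx, add_zero]
    exact directedGen_cons_of_ne e hx w

theorem rootedGen_pow_prime : rootedGen p ^ p = 1 := by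
  have h : ∀ (n : ℕ) (x : ZMod p) (w : TreeVertex p), (rootedGen p ^ n) (x :: w) = (x + n) :: w := by
    intro n
    induction n with
    | zero => intro x w; simp
    | succ n ih =>
      intro x w
      rw [pow_succ, RelIso.mul_apply, rootedGen_cons, ih]
      congr 1; push_cast; ring
  refine RelIso.ext fun w => ?_
  cases w with
  | nil =>
    have h2 : ∀ n : ℕ, (rootedGen p ^ n) [] = [] := by
      intro n
      induction n with
      | zero => rfl
      | succ n ih => rw [pow_succ, RelIso.mul_apply]; exact ih
    exact h2 p
  | cons x w => rw [h, ZMod.natCast_self, add_zero]; rfl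

theorem directedGen_pow_prime : directedGen e ^ p = 1 := by
  have h0 : ∀ (n : ℕ) w, (directedGen e ^ n) (0 :: w) = 0 :: (directedGen e ^ n) w := by
    intro n
    induction n with
    | zero => intro w; rfl
    | succ n ih =>
      intro w
      rw [pow_succ, RelIso.mul_apply, directedGen_cons_zero, ih, RelIso.mul_apply]
  have h1 : ∀ (n : ℕ) (x : ZMod p) w, x ≠ 0 → (directedGen e ^ n) (x :: w) =
      x :: ((rootedGen p ^ (tupleExtension e x).val) ^ n) w := by
    intro n
    induction n with
    | zero => intro x w _; rfl
    | succ n ih =>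
      intro x w hx
      rw [pow_succ, RelIso.mul_apply, directedGen_cons_of_ne e hx, ih _ _ hx, pow_succ _ n,
        RelIso.mul_apply]
  have h2 : ∀ n : ℕ, (directedGen e ^ n) [] = [] := by
    intro n
    induction n with
    | zero => rfl
    | succ n ih => rw [pow_succ, RelIso.mul_apply]; exact ih
  refine RelIso.ext fun w => ?_
  induction w with
  | nil => exact h2 p
  | cons x w ih =>
    by_cases hx : x = 0
    · subst hx
      rw [h0, ih]; rfl
    · rw [h1 _ _ _ hx, ← pow_mul, mul_comm, pow_mul, rootedGen_pow_prime, one_pow]; rfl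

/-- The self-similarity structure of a GGS-group. -/
noncomputable def GGSGroup.data (hp : p ≠ 2)
    (hE : ∃ x y, x ≠ 0 ∧ y ≠ 0 ∧ tupleExtension e x ≠ tupleExtension e y) :
    GGSData p (tupleExtension e) (GGSGroup e) where
  odd := hp
  E_zero := dif_pos rfl
  E_nonconst := hE
  a := GGSGroup.a e
  b := GGSGroup.b e
  lvl := GGSGroup.lvl e
  sec := GGSGroup.sec e
  lvl_mul g h := (GGSGroup.mul_unique e g h).1
  sec_mul g h := (GGSGroup.mul_unique e g h).2
  ext_one g h1 h2 := by
    refine Subtype.ext (RelIso.ext fun w => ?_)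
    cases w with
    | nil => exact GGSGroup.apply_nil e g
    | cons x w => rw [GGSGroup.apply_cons, h1, h2, add_zero]; rfl
  lvl_a := (GGSGroup.lvl_sec_a e).1
  lvl_b := (GGSGroup.lvl_sec_b e).1
  sec_a := (GGSGroup.lvl_sec_a e).2
  sec_b := (GGSGroup.lvl_sec_b e).2
  a_pow := Subtype.ext rootedGen_pow_prime
  b_pow := Subtype.ext (directedGen_pow_prime e)
  closure_eq := by
    have h := Subgroup.closure_closure_coe_preimage (k := {rootedGen p, directedGen e})
    refine Eq.trans ?_ h
    congr 1
    ext g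
    simp only [GGSGroup.a, GGSGroup.b, Set.mem_insert_iff, Set.mem_singleton_iff, Subtype.ext_iff]
    rfl

end TreeSections

/-! ### Translating conditions on tuples into conditions on functions on F_p -/

section TupleConditions

variable {p : ℕ} [Fact p.Prime] (e : Fin (p - 1) → ZMod p)

theorem natCast_add_one_ne_zero {n : ℕ} (h : n < p - 1) : (n : ZMod p) + 1 ≠ 0 := by
  rw [← Nat.cast_succ, Ne, ZMod.natCast_eq_zero_iff]
  exact Nat.not_dvd_of_pos_of_lt (by omega) (by omega)

theorem apply_eq_tupleExtension (n : ℕ) (h : n < p - 1) :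
    e ⟨n, h⟩ = tupleExtension e ((n : ZMod p) + 1) := by
  rw [tupleExtension, dif_neg (natCast_add_one_ne_zero h), tupleEntry]
  congr 2
  rw [← Nat.cast_succ, ZMod.val_cast_of_lt (by omega), Nat.succ_sub_one]

theorem exists_natCast_add_one {x : ZMod p} (hx : x ≠ 0) :
    ∃ n : ℕ, n < p - 1 ∧ x = (n : ZMod p) + 1 := by
  have h1 := ZMod.val_lt x
  have h2 : x.val ≠ 0 := (ZMod.val_ne_zero x).2 hx
  refine ⟨x.val - 1, by omega, ?_⟩
  rw [← Nat.cast_succ, Nat.succ_eq_add_one, Nat.sub_add_cancel (by omega), ZMod.natCast_zmod_val]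

theorem exists_ne_of_not_isConstantTuple (he : ¬ IsConstantTuple e) :
    ∃ x y, x ≠ 0 ∧ y ≠ 0 ∧ tupleExtension e x ≠ tupleExtension e y := by
  rw [IsConstantTuple] at he
  push Not at he
  obtain ⟨i, j, h⟩ := he
  refine ⟨_, _, natCast_add_one_ne_zero i.2, natCast_add_one_ne_zero j.2, ?_⟩
  rwa [← apply_eq_tupleExtension, ← apply_eq_tupleExtension]

theorem natCast_sub_eq {n m : ℕ} (h : n + m = p) : (n : ZMod p) = -(m : ZMod p) := by
  rw [eq_neg_iff_add_eq_zero, ← Nat.cast_add, h, ZMod.natCast_self]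

theorem isSymmetricTuple_iff :
    IsSymmetricTuple e ↔ ∀ x, tupleExtension e (-x) = tupleExtension e x := by
  have h1 : ∀ (n : ℕ) (h : n < p - 1),
      e (Fin.rev ⟨n, h⟩) = tupleExtension e (-((n : ZMod p) + 1)) := by
    intro n h
    -- Index n carries the letter n + 1, so reversal of the tuple is negation of letters.
    rw [← Nat.cast_succ, ← natCast_sub_eq (n := p - 1 - (n + 1) + 1) (by omega), Nat.cast_succ]
    exact apply_eq_tupleExtension e _ _
  constructor
  · intro h x
    by_cases hx : x = 0
    · rw [hx, neg_zero]
    · obtain ⟨n, hn, rfl⟩ := exists_natCast_add_one hx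
      rw [← h1 n hn, ← apply_eq_tupleExtension e n hn, h, Fin.rev_rev]
  · rintro h ⟨n, hn⟩
    rw [h1 n hn, h, apply_eq_tupleExtension e]

theorem diffTuple_apply (n : ℕ) (h : n < p - 1 - 1) : diffTuple e ⟨n, h⟩ =
    tupleExtension e ((n : ZMod p) + 1) - tupleExtension e ((n : ZMod p) + 2) := by
  rw [diffTuple, apply_eq_tupleExtension e, apply_eq_tupleExtension e]
  congr 2; push_cast; ring

/-- Constant differences mean an arithmetic progression on the letters 1, …, p - 1; s and t are read
off from the letters 1 and 2. -/
theorem isConstantTuple_diffTuple_iff :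
    IsConstantTuple (diffTuple e) ↔ ∃ s t, ∀ x, x ≠ 0 → tupleExtension e x = s * x + t := by
  have hp2 := (Fact.out : p.Prime).two_le
  constructor
  · intro h
    refine ⟨tupleExtension e 2 - tupleExtension e 1,
      2 * tupleExtension e 1 - tupleExtension e 2, fun x hx => ?_⟩
    obtain ⟨n, hn, rfl⟩ := exists_natCast_add_one hx
    clear hx
    induction n with
    | zero => simp; ring
    | succ n ih =>
      have h1 := h ⟨n, by omega⟩ ⟨0, by omega⟩
      rw [diffTuple_apply, diffTuple_apply] at h1
      have h2 := ih (by omega)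
      rw [show ((n + 1 : ℕ) : ZMod p) + 1 = n + 2 by push_cast; ring]
      simp only [Nat.cast_zero, zero_add] at h1
      linear_combination h2 - h1
  · rintro ⟨s, t, h⟩
    have h1 : ∀ i, diffTuple e i = -s := by
      rintro ⟨n, hn⟩
      have h2 := natCast_add_one_ne_zero (p := p) (n := n) (by omega)
      have h3 := natCast_add_one_ne_zero (p := p) (n := n + 1) (by omega)
      rw [show ((n + 1 : ℕ) : ZMod p) + 1 = n + 2 by push_cast; ring] at h3
      rw [diffTuple_apply, h _ h2, h _ h3]; ring
    exact fun i j => (h1 i).trans (h1 j).symm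

/-- Symmetry says that the second differences of the odd part g vanish, so g is affine on 1, …, p -
1. Oddness then removes the constant term. -/
theorem isSymmetricTuple_diffTuple_iff (hp : p ≠ 2) :
    IsSymmetricTuple (diffTuple (diffTuple e)) ↔
      ∃ l, ∀ x, tupleExtension e x - tupleExtension e (-x) = l * x := by
  have hp2 := (Fact.out : p.Prime).two_le
  have hd : ∀ (n : ℕ) (h : n < p - 1 - 1 - 1), diffTuple (diffTuple e) ⟨n, h⟩ =
      tupleExtension e ((n : ZMod p) + 1) - 2 * tupleExtension e ((n : ZMod p) + 2) +
        tupleExtension e ((n : ZMod p) + 3) := by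
    intro n h
    rw [diffTuple, diffTuple_apply, diffTuple_apply,
      show ((n + 1 : ℕ) : ZMod p) + 1 = n + 2 by push_cast; ring,
      show ((n + 1 : ℕ) : ZMod p) + 2 = n + 3 by push_cast; ring]
    ring
  have hr : ∀ (n : ℕ) (h : n < p - 1 - 1 - 1), diffTuple (diffTuple e) (Fin.rev ⟨n, h⟩) =
      tupleExtension e (-((n : ZMod p) + 3)) - 2 * tupleExtension e (-((n : ZMod p) + 2)) +
        tupleExtension e (-((n : ZMod p) + 1)) := by
    intro n h
    have h1 : ((p - 1 - 1 - 1 - (n + 1) : ℕ) : ZMod p) = -((n + 4 : ℕ) : ZMod p) :=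
      natCast_sub_eq (by omega)
    refine (hd _ (by omega)).trans ?_
    rw [h1]
    push_cast
    rw [show -((n : ZMod p) + 4) + 1 = -(n + 3) by ring,
      show -((n : ZMod p) + 4) + 2 = -(n + 2) by ring,
      show -((n : ZMod p) + 4) + 3 = -(n + 1) by ring]
  set g : ZMod p → ZMod p := fun x => tupleExtension e x - tupleExtension e (-x) with hg
  have hiff : IsSymmetricTuple (diffTuple (diffTuple e)) ↔ ∀ n : ℕ, n + 3 < p →
      g ((n : ZMod p) + 3) = 2 * g ((n : ZMod p) + 2) - g ((n : ZMod p) + 1) := by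
    constructor
    · intro h n hn
      have h1 := h ⟨n, by omega⟩
      rw [hd, hr] at h1
      simp only [hg]
      linear_combination h1
    · rintro h ⟨n, hn⟩
      have h1 := h n (by omega)
      rw [hd, hr]
      simp only [hg] at h1
      linear_combination h1
  rw [hiff]
  constructor
  · intro h
    have key : ∀ n : ℕ, n + 2 < p → g ((n : ZMod p) + 1) = g 1 + n * (g 2 - g 1) ∧
        g ((n : ZMod p) + 2) = g 1 + (n + 1) * (g 2 - g 1) := by
      intro n
      induction n with
      | zero => intro _; simp
      | succ n ih =>
        intro hn
        obtain ⟨h1, h2⟩ := ih (by omega)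
        have h3 := h n (by omega)
        rw [show ((n + 1 : ℕ) : ZMod p) + 1 = n + 2 by push_cast; ring,
          show ((n + 1 : ℕ) : ZMod p) + 2 = n + 3 by push_cast; ring, h3, h1, h2]
        push_cast
        constructor <;> ring
    -- This is the value at the last letter p - 1 = -1, compared below with g (-1) = -g 1.
    have h3 := (key (p - 3) (by omega)).2
    have h4 : ((p - 3 : ℕ) : ZMod p) = -((3 : ℕ) : ZMod p) := natCast_sub_eq (by omega)
    rw [h4, show (-((3 : ℕ) : ZMod p) + 2) = -1 by push_cast; ring] at h3
    have h5 : g (-1) = -g 1 := by simp only [hg, neg_neg]; ring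
    have h6 : g 2 - g 1 = g 1 := by
      refine mul_left_cancel₀ (ZMod.two_ne_zero_of_ne hp) ?_
      rw [h5] at h3
      push_cast at h3
      linear_combination h3
    refine ⟨g 1, fun x => ?_⟩
    by_cases hx : x = 0
    · simp [hx]
    · obtain ⟨n, hn, rfl⟩ := exists_natCast_add_one hx
      change g _ = _
      cases n with
      | zero => simp
      | succ n =>
        have h7 := (key n (by omega)).2
        rw [show ((n + 1 : ℕ) : ZMod p) + 1 = n + 2 by push_cast; ring, h7, h6]
        ring
  · rintro ⟨l, hl⟩ n _
    have h1 : ∀ x, g x = l * x := hl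
    rw [h1, h1, h1]; ring

end TupleConditions

theorem mainTheorem1 (p : ℕ) [Fact p.Prime] (hp : Odd p) (e : Fin (p - 1) → ZMod p)
    (he : ¬ IsConstantTuple e) :
    ((derivedSeries (GGSGroup e) 1).index ≠ 0 ∧
      Real.logb p (derivedSeries (GGSGroup e) 1).index = 2) ∧
    ∀ n : ℕ, 2 ≤ n →
      (derivedSeries (GGSGroup e) n).index ≠ 0 ∧
      Real.logb p (derivedSeries (GGSGroup e) n).index =
        (p : ℝ) ^ (n - 2) * (p + con (diffTuple e) + sym (diffTuple (diffTuple e)))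
          - ((p : ℝ) ^ (n - 1) - 1) / ((p : ℝ) - 1) * sym e + 1 := by
  have hp2 : p ≠ 2 := by rintro rfl; exact absurd hp (by decide)
  have hprime : p.Prime := Fact.out
  have hp1 : (1 : ℝ) < p := by exact_mod_cast hprime.one_lt
  have hlog : ∀ l : ℕ, Real.logb p ((p ^ l : ℕ) : ℝ) = l := fun l => by
    rw [Nat.cast_pow, Real.logb_pow, Real.logb_self_eq_one hp1, mul_one]
  let D := GGSGroup.data e hp2 (exists_ne_of_not_isConstantTuple e he)
  refine ⟨?_, fun n hn => ?_⟩
  · rw [derivedSeries_one, D.index_commutator, hlog]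
    exact ⟨pow_ne_zero _ hprime.ne_zero, by norm_num⟩
  · obtain ⟨n, rfl⟩ := Nat.exists_eq_add_of_le' hn
    obtain ⟨l, hl, hlr⟩ := D.index_derivedSeries n
    rw [hl, hlog, hlr]
    refine ⟨pow_ne_zero _ hprime.ne_zero, ?_⟩
    simp only [con, sym, isConstantTuple_diffTuple_iff e, isSymmetricTuple_diffTuple_iff e hp2,
      isSymmetricTuple_iff, Nat.add_sub_cancel, show n + 2 - 1 = n + 1 by omega]
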